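/- Let $\Bbbk$ be an algebraically closed field of characteristic zero, let $t,a,b,p\in\Bbbk$ with $t\neq 0$, and let $V$ be the vector space with basis $x_1,x_2,x_3$ and with the braiding $c$ (associated to the $R$-matrix $\mathfrak{R}_{1,4}$) given by $$\begin{aligned} c(x_i\otimes x_i)&=t\,x_i\otimes x_i\ (i=1,2), \qquad c(x_1\otimes x_2)=t\,x_2\otimes x_1,\qquad c(x_2\otimes x_1)=t\,x_1\otimes x_2,\\ c(x_1\otimes x_3)&=t\,x_3\otimes x_1-ta\,x_1\otimes x_1,\qquad c(x_3\otimes x_1)=t\,x_1\otimes x_3+ta\,x_1\otimes x_1,\\ c(x_2\otimes x_3)&=t\,x_3\otimes x_2+t(a-2b)\,x_1\otimes x_2,\qquad c(x_3\otimes x_2)=t\,x_2\otimes x_3+t(2b-a)\,x_2\otimes x_1,\\ c(x_3\otimes x_3)&=t\,x_3\otimes x_3+tb\,x_3\otimes x_1-tb\,x_1\otimes x_3+tp\,x_1\otimes x_2-tab\,x_1\otimes x_1 . \end{aligned}$$ Let $\mathcal{J}(V)$ be the largest homogeneous Hopf ideal of the braided Hopf algebra $T(V)$ that is generated by elements of degree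 $\geq 2$, and let $\mathfrak{B}(V)=T(V)/\mathcal{J}(V)$ be the Nichols algebra of $V$. Write $\mathcal{J}_2(V)$ for the component of $\mathcal{J}(V)$ in degree 2, and $\operatorname{GKdim}$ for the Gelfand–Kirillov dimension. Then: 1. If $t^2\neq 1$, then $\mathfrak{B}(V)$ has no quadratic relations, that is, $\mathcal{J}_2(V)=0$. 2. If $t=1$, then $$\mathcal{J}(V)=\langle x_2x_1-x_1x_2,\ x_3x_1-x_1x_3-a\,x_1^2,\ x_3x_2-x_2x_3+(a-2b)\,x_1x_2\rangle,$$ the monomials $x_1^{a_1}x_2^{a_2}x_3^{a_3}$ with $a_i\geq 0$ form a basis of $\mathfrak{B}(V)$, and $\operatorname{GKdim}\mathfrak{B}(V)=3$. 3. If $t=-1$ and $p\neq 0$, then $$\mathcal{J}(V)=\langle x_2x_1+x_1x_2,\ x_3x_1+x_1x_3,\ x_3x_2+x_2x_3+(a-2b)\,x_1x_2,\ x_1^2,\ x_2^2\rangle,$$ the monomials $x_1^{a_1}x_2^{a_2}x_3^{a_3}$ with $0\leq a_1,a_2<2$ and $a_3\geq 0$ form a basis of $\mathfrak{B}(V)$,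 and $\operatorname{GKdim}\mathfrak{B}(V)=1$. 4. If $t=-1$ and $p=0$, then $$\mathcal{J}(V)=\langle x_2x_1+x_1x_2,\ x_3x_1+x_1x_3,\ x_3x_2+x_2x_3+(a-2b)\,x_1x_2,\ x_1^2,\ x_2^2,\ x_3^2-b\,x_1x_3\rangle,$$ the monomials $x_1^{a_1}x_2^{a_2}x_3^{a_3}$ with $0\leq a_i<2$ form a basis of $\mathfrak{B}(V)$, $\operatorname{GKdim}\mathfrak{B}(V)=0$, and $\dim\mathfrak{B}(V)=8$. -/

import Mathlib

open scoped TensorProduct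

namespace BraidedRank

/-- A braided vector space `(V, c)` with a chosen finite basis `(x_i)`, `i : ι`, where
`c (x_i ⊗ x_j) = ∑ l m, coeff i j l m • (x_l ⊗ x_m)`.
`inv_coeff` and `coeff_inv` say that `c` is invertible on `V ⊗ V` (with inverse given by `inv`);
`braid` is the braid equation
`(c ⊗ id)(id ⊗ c)(c ⊗ id) = (id ⊗ c)(c ⊗ id)(id ⊗ c)`, read off on the coefficient of
`x_d ⊗ x_e ⊗ x_f` in the image of `x_i ⊗ x_j ⊗ x_l`. -/
structure Braiding (k ι : Type*) [Field k] [Fintype ι] [DecidableEq ι] where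
  coeff : ι → ι → ι → ι → k
  inv : ι → ι → ι → ι → k
  coeff_inv : ∀ i j d e : ι,
    ∑ u, ∑ v, coeff i j u v * inv u v d e = if i = d ∧ j = e then 1 else 0
  inv_coeff : ∀ i j d e : ι,
    ∑ u, ∑ v, inv i j u v * coeff u v d e = if i = d ∧ j = e then 1 else 0
  braid : ∀ i j l d e f : ι,
    ∑ u, ∑ v, coeff i j u v * ∑ w, coeff v l w f * coeff u w d e =
      ∑ u, ∑ v, coeff j l u v * ∑ w, coeff i u d w * coeff w v e f

section Nichols

variable {k ι : Type*} [Field k] [Fintype ι] [DecidableEq ι]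

/-- The tensor algebra `T(V)`, for `V` with basis indexed by `ι`: noncommutative polynomials. -/
abbrev T (k ι : Type*) [Field k] : Type _ := FreeAlgebra k ι

/-- The homogeneous component `T^n(V)`, spanned by the words of length `n`. -/
def deg (k ι : Type*) [Field k] (n : ℕ) : Submodule k (T k ι) :=
  Submodule.span k {w | ∃ l : List ι, l.length = n ∧ w = (l.map (FreeAlgebra.ι k)).prod}

/-- The extension of `c` to `V ⊗ T(V) → T(V) ⊗ V`, written as
`c (x_i ⊗ u) = ∑ j, (extend B u) i j ⊗ x_j`. The compatibility of `c` with the multiplication,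
`c (x_i ⊗ u u') = ∑ j, (extend B u) i j • c (x_j ⊗ u')`, says precisely that `extend B` is
an algebra map to matrices over `T(V)`. -/
noncomputable def extend (B : Braiding k ι) : T k ι →ₐ[k] Matrix ι ι (T k ι) :=
  FreeAlgebra.lift k fun m => Matrix.of fun i j => ∑ l, B.coeff i m l j • FreeAlgebra.ι k l

/-- The linear map `u ↦ (extend B u) i j` from `T(V)` to `T(V)`. -/
noncomputable def extendEntry (B : Braiding k ι) (i j : ι) : T k ι →ₗ[k] T k ι :=
  Matrix.entryLinearMap k (T k ι) i j ∘ₗ (extend B).toLinearMap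

/-- Left multiplication by `x_i ⊗ 1 + 1 ⊗ x_i` in the braided tensor product algebra
`T(V) ⊗ T(V)`, whose product is `(u ⊗ v)(u' ⊗ v') = u c(v ⊗ u') v'`. Thus `u ⊗ v` goes to
`x_i u ⊗ v + ∑ j, (extend B u) i j ⊗ x_j v`. -/
noncomputable def primitiveMul (B : Braiding k ι) (i : ι) :
    T k ι ⊗[k] T k ι →ₗ[k] T k ι ⊗[k] T k ι :=
  TensorProduct.map (LinearMap.mulLeft k (FreeAlgebra.ι k i)) LinearMap.id +
    ∑ j, TensorProduct.map (extendEntry B i j) (LinearMap.mulLeft k (FreeAlgebra.ι k j))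

/-- The comultiplication of the braided Hopf algebra `T(V)`: the algebra map from `T(V)` to the
braided tensor product `T(V) ⊗ T(V)` with `x_i ↦ x_i ⊗ 1 + 1 ⊗ x_i`. -/
noncomputable def comul (B : Braiding k ι) : T k ι →ₗ[k] T k ι ⊗[k] T k ι :=
  LinearMap.applyₗ (1 ⊗ₜ[k] 1) ∘ₗ
    (FreeAlgebra.lift k (A := Module.End k (T k ι ⊗[k] T k ι)) (primitiveMul B)).toLinearMap

/-- The underlying subspace of a two-sided ideal of `T(V)`. -/
def toSub (I : TwoSidedIdeal (T k ι)) : Submodule k (T k ι) :=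
  (TwoSidedIdeal.asIdeal I).restrictScalars k

/-- The subspace `I ⊗ T(V) + T(V) ⊗ I` of `T(V) ⊗ T(V)`. -/
def coidealSub (I : TwoSidedIdeal (T k ι)) : Submodule k (T k ι ⊗[k] T k ι) :=
  Submodule.span k {z | ∃ u v : T k ι, (u ∈ I ∨ v ∈ I) ∧ z = u ⊗ₜ[k] v}

/-- Homogeneous Hopf ideals of `T(V)` generated in degrees at least two. The counit vanishes on
such an ideal for degree reasons, and the ideal is stable under the antipode because `T(V)` is
graded and connected. -/
structure IsHopfIdeal (B : Braiding k ι) (I : TwoSidedIdeal (T k ι)) : Prop where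
  homogeneous : toSub I ≤ ⨆ n ≥ 2, toSub I ⊓ deg k ι n
  coideal : ∀ u ∈ I, comul B u ∈ coidealSub I

/-- The ideal `J(V)` of relations of the Nichols algebra: the largest homogeneous Hopf ideal of
`T(V)` in degrees at least two. No stability under `c` is demanded of the ideals here: the
largest one, which is the direct sum of the kernels of the quantum symmetrizers, is stable under
`c` anyway, so demanding it would give the same ideal. -/
def nicholsIdeal (B : Braiding k ι) : TwoSidedIdeal (T k ι) :=
  sSup {I | IsHopfIdeal B I}

/-- The largest homogeneous Hopf ideal exists. -/
theorem nicholsIdeal_isGreatest (B : Braiding k ι) :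
    IsGreatest {I | IsHopfIdeal B I} (nicholsIdeal B) := by
  refine ⟨?_, fun I hI => le_sSup hI⟩
  set S : Submodule k (T k ι) := ⨆ I ∈ {I | IsHopfIdeal B I}, toSub I with hS
  have hle : ∀ I, IsHopfIdeal B I → toSub I ≤ S := fun I hI =>
    le_iSup₂_of_le (f := fun I (_ : I ∈ {I | IsHopfIdeal B I}) => toSub I) I hI le_rfl
  have hmulL : ∀ x y, y ∈ S → x * y ∈ S := by
    intro x y hy
    have : S ≤ S.comap (LinearMap.mulLeft k x) :=
      iSup₂_le fun I hI z hz => hle I hI (I.mul_mem_left x z hz)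
    exact this hy
  have hmulR : ∀ x y, x ∈ S → x * y ∈ S := by
    intro x y hx
    have : S ≤ S.comap (LinearMap.mulRight k y) :=
      iSup₂_le fun I hI z hz => hle I hI (I.mul_mem_right z y hz)
    exact this hx
  let J : TwoSidedIdeal (T k ι) := TwoSidedIdeal.mk' (S : Set (T k ι)) S.zero_mem
    S.add_mem S.neg_mem (fun {x y} h => hmulL x y h) (fun {x y} h => hmulR x y h)
  have hJ : ∀ x, x ∈ J ↔ x ∈ S := fun x => by simp [J]
  have hJN : nicholsIdeal B ≤ J :=
    sSup_le fun I hI x hx => (hJ x).2 (hle I hI hx)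
  have hNS : toSub (nicholsIdeal B) ≤ S := fun x hx => (hJ x).1 (hJN hx)
  have hIN : ∀ I, IsHopfIdeal B I → I ≤ nicholsIdeal B := fun I hI => le_sSup hI
  refine ⟨hNS.trans (iSup₂_le fun I hI => hI.homogeneous.trans ?_), fun u hu => ?_⟩
  · exact iSup₂_mono fun n _ => inf_le_inf_right _ fun x hx => hIN I hI hx
  · have : S ≤ (coidealSub (nicholsIdeal B)).comap (comul B) := by
      refine iSup₂_le fun I hI x hx => ?_
      refine Submodule.span_mono ?_ (hI.coideal x hx)
      rintro z ⟨u, v, h, rfl⟩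
      exact ⟨u, v, h.imp (fun h => hIN I hI h) (fun h => hIN I hI h), rfl⟩
    exact this (hNS hu)

/-- The Nichols algebra `T(V) / J(V)`. -/
abbrev NicholsAlgebra (B : Braiding k ι) : Type _ := (nicholsIdeal B).ringCon.Quotient

/-- The quadratic relations of the Nichols algebra, `J_2(V) = J(V) ∩ T^2(V)`. -/
def quadraticRelations (B : Braiding k ι) : Submodule k (T k ι) :=
  toSub (nicholsIdeal B) ⊓ deg k ι 2

end Nichols

/-- The monomials `x_1^{e_1} x_2^{e_2} x_3^{e_3}`, for exponents `e` in `S`, form a basis of the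
Nichols algebra of a braided vector space of dimension three. -/
def IsMonomialBasis {k : Type*} [Field k] (B : Braiding k (Fin 3)) (S : Set (Fin 3 → ℕ)) : Prop :=
  let x : Fin 3 → NicholsAlgebra B := fun i =>
    (nicholsIdeal B).ringCon.mk' (FreeAlgebra.ι k i)
  let v : S → NicholsAlgebra B := fun e => x 0 ^ e.1 0 * x 1 ^ e.1 1 * x 2 ^ e.1 2
  LinearIndependent k v ∧ Submodule.span k (Set.range v) = ⊤

/-- Exponents of `B_0`. -/
def B₀ : Set (Fin 3 → ℕ) := {e | ∀ i, e i < 2}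

/-- Exponents of `B_1`. -/
def B₁ : Set (Fin 3 → ℕ) := {e | e 0 < 2 ∧ e 1 < 2}

/-- Exponents of `B_3`. -/
def B₃ : Set (Fin 3 → ℕ) := Set.univ

/-- The Gelfand--Kirillov dimension of a `k`-algebra: the supremum over its finite-dimensional
subspaces `W` of `limsup_n log (dim (k + W)^n) / log n`, where `(k + W)^n = k + W + ⋯ + W^n`. -/
noncomputable def gkDim (k A : Type*) [Field k] [Ring A] [Algebra k A] : EReal :=
  ⨆ W : {W : Submodule k A // W.FG}, Filter.limsup (fun n : ℕ =>
    ((Real.log (Module.finrank k ((1 ⊔ W.1) ^ n : Submodule k A)) / Real.log n : ℝ) : EReal))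
    Filter.atTop

section R14

variable {k : Type*} [Field k]

/-- The `R`-matrix `R_{1,4}`. Rows are indexed by `11, 12, 13, 21, 22, 23, 31, 32, 33` and
columns by `11, 21, 31, 12, 22, 32, 13, 23, 33`. -/
def R14 (t a b p : k) : Matrix (Fin 9) (Fin 9) k :=
  !![t, 0, t * a, 0, 0, 0, -(t * a), 0, -(t * a * b);
     0, t, 0, 0, 0, 0, 0, t * (a - 2 * b), t * p;
     0, 0, t, 0, 0, 0, 0, 0, -(t * b);
     0, 0, 0, t, 0, t * (2 * b - a), 0, 0, 0;
     0, 0, 0, 0, t, 0, 0, 0, 0;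
     0, 0, 0, 0, 0, t, 0, 0, 0;
     0, 0, 0, 0, 0, 0, t, 0, t * b;
     0, 0, 0, 0, 0, 0, 0, t, 0;
     0, 0, 0, 0, 0, 0, 0, 0, t]

/-- The entry `r^{ij}_{lm}`, in the row `lm` and the column `ij`
(`finProdFinEquiv (u, v)` is `3 u + v`). -/
def r14 (t a b p : k) (i j l m : Fin 3) : k :=
  R14 t a b p (finProdFinEquiv (l, m)) (finProdFinEquiv (j, i))

/-- The matrix of the inverse braiding, with the same labels of rows and columns. -/
def R14Inv (t a b p : k) : Matrix (Fin 9) (Fin 9) k :=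
  !![t⁻¹, 0, t⁻¹ * a, 0, 0, 0, -(t⁻¹ * a), 0, -(t⁻¹ * a * b);
     0, t⁻¹, 0, 0, 0, 0, 0, t⁻¹ * (a - 2 * b), 0;
     0, 0, t⁻¹, 0, 0, 0, 0, 0, -(t⁻¹ * b);
     0, 0, 0, t⁻¹, 0, t⁻¹ * (2 * b - a), 0, 0, -(t⁻¹ * p);
     0, 0, 0, 0, t⁻¹, 0, 0, 0, 0;
     0, 0, 0, 0, 0, t⁻¹, 0, 0, 0;
     0, 0, 0, 0, 0, 0, t⁻¹, 0, t⁻¹ * b;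
     0, 0, 0, 0, 0, 0, 0, t⁻¹, 0;
     0, 0, 0, 0, 0, 0, 0, 0, t⁻¹]

def r14Inv (t a b p : k) (i j l m : Fin 3) : k :=
  R14Inv t a b p (finProdFinEquiv (l, m)) (finProdFinEquiv (j, i))

/-- The value of the braiding `x_i ⊗ x_j ↦ ∑ r^{ij}_{uv} x_u ⊗ x_v`, tested on `g`. -/
theorem r14_sum (t a b p : k) (i j : Fin 3) (g : Fin 3 → Fin 3 → k) :
    ∑ u, ∑ v, r14 t a b p i j u v * g u v = t * (g j i +
      (if i = 2 ∧ j = 0 then a * g 0 0 else 0) - (if i = 0 ∧ j = 2 then a * g 0 0 else 0) +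
      (if i = 2 ∧ j = 1 then (2 * b - a) * g 1 0 else 0) -
      (if i = 1 ∧ j = 2 then (2 * b - a) * g 0 1 else 0) +
      (if i = 2 ∧ j = 2 then b * g 2 0 - b * g 0 2 + p * g 0 1 - a * b * g 0 0 else 0)) := by
  fin_cases i <;> fin_cases j <;>
    simp [r14, R14, Fin.sum_univ_three, finProdFinEquiv] <;> ring

theorem r14Inv_sum (t a b p : k) (i j : Fin 3) (g : Fin 3 → Fin 3 → k) :
    ∑ u, ∑ v, r14Inv t a b p i j u v * g u v = t⁻¹ * (g j i +
      (if i = 2 ∧ j = 0 then a * g 0 0 else 0) - (if i = 0 ∧ j = 2 then a * g 0 0 else 0) +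
      (if i = 2 ∧ j = 1 then (2 * b - a) * g 1 0 else 0) -
      (if i = 1 ∧ j = 2 then (2 * b - a) * g 0 1 else 0) +
      (if i = 2 ∧ j = 2 then b * g 2 0 - b * g 0 2 - p * g 1 0 - a * b * g 0 0 else 0)) := by
  fin_cases i <;> fin_cases j <;>
    simp [r14Inv, R14Inv, Fin.sum_univ_three, finProdFinEquiv] <;> ring

theorem r14_braid_aux (t a b p : k) (i j l : Fin 3) (g : Fin 3 → Fin 3 → Fin 3 → k) :
    ∑ u, ∑ v, r14 t a b p i j u v * ∑ w, ∑ f, r14 t a b p v l w f *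
        ∑ d, ∑ e, r14 t a b p u w d e * g d e f =
      ∑ u, ∑ v, r14 t a b p j l u v * ∑ d, ∑ w, r14 t a b p i u d w *
        ∑ e, ∑ f, r14 t a b p w v e f * g d e f := by
  simp only [r14_sum]
  fin_cases i <;> fin_cases j <;> fin_cases l <;>
    simp [-mul_eq_mul_left_iff] <;> ring

/-- The braided vector space attached to `R_{1,4}`, with
`c (x_i ⊗ x_j) = ∑ l m, r^{ij}_{lm} x_l ⊗ x_m`. -/
def braiding14 (t a b p : k) (ht : t ≠ 0) : Braiding k (Fin 3) where
  coeff := r14 t a b p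
  inv := r14Inv t a b p
  coeff_inv i j d e := by
    have h := r14_sum t a b p i j (fun u v => r14Inv t a b p u v d e)
    rw [h]
    fin_cases i <;> fin_cases j <;> fin_cases d <;> fin_cases e <;>
      simp [r14Inv, R14Inv, finProdFinEquiv, ht] <;> ring
  inv_coeff i j d e := by
    have h := r14Inv_sum t a b p i j (fun u v => r14 t a b p u v d e)
    rw [h]
    fin_cases i <;> fin_cases j <;> fin_cases d <;> fin_cases e <;>
      simp [r14, R14, finProdFinEquiv, ht] <;> field_simp <;> ring
  braid i j l d e f := by
    have h := r14_braid_aux t a b p i j l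
      (fun d' e' f' => if d' = d then if e' = e then if f' = f then 1 else 0 else 0 else 0)
    simpa using h

end R14

end BraidedRank

/-! Everything rests on the quadratic part of the ideal J = J(V) and on skew derivations.

A tensor f in the kernel of 1 + c gives an element of T(V) that is primitive, because the mixed
terms of its coproduct are the coefficients of (1 + c)f. By the braid equation c moves generators
across this kernel in both directions, so the ideal generated by the kernel is a homogeneous Hopf
ideal and lies in J (`quad_mem_nicholsIdeal`). Conversely, contracting the first factor of the
coproduct with the coefficient of x_l gives a skew derivation ∂_l that preserves J (`der_mem`; the
Lean index is l - 1), and elements of J have no constant or linear part. Hence J_2 is exactly the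
kernel of 1 + c (`inKer_of_quad_mem`). Solving a triangular linear system gives J_2 = 0 for t^2 ≠ 1,
and for t = ±1 one checks that the listed relations lie in the kernel.

These relations rewrite every element as a combination of the ordered monomials in question, without
raising the degree (`IsStraightening`). The monomials are independent modulo J
(`coeff_eq_zero_of_sum_mem`): a power of ∂_2 strips x_2, an operator Ψ_N isolates x_3^N, a power of
∂_1 strips x_1, and the counit reads off a nonzero scalar. The resulting functionals vanish on J and
are triangular on monomials. For t = 1, and for t = -1 with all exponents below two, Ψ_N = ∂_3^N
works, since the t-factorials involved are nonzero. For t = -1 and p ≠ 0, ∂_3^2 no longer detects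
x_3^2, but modulo x_1 the operator ∂_2∂_1 sends x_3^n to -p⌊n/2⌋ x_3^(n-2), so Ψ_N = ∂_3^(N mod 2)
(∂_2∂_1)^⌊N/2⌋ works in characteristic zero.

Spanning modulo the relations and independence modulo J together force J to be generated by the
relations (`nicholsIdeal_eq_span`) and give the basis. The Gelfand–Kirillov dimension then comes
from counting basis monomials of degree at most n (`gkDim_eq`). -/

namespace BraidedRank

/-! ### The kernel of 1 + c generates a Hopf ideal. -/

section General

variable {k ι : Type*} [Field k] [Fintype ι] [DecidableEq ι]

/-- Induction on elements of the tensor algebra by left multiplication with generators. -/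
theorem T_induction {ι : Type*} {p : T k ι → Prop} (one : p 1)
    (mul : ∀ i u, p u → p (FreeAlgebra.ι k i * u))
    (add : ∀ u v, p u → p v → p (u + v)) (smul : ∀ (r : k) u, p u → p (r • u)) (u : T k ι) :
    p u := by
  have key : ∀ u v : T k ι, p v → p (u * v) := by
    intro u
    refine FreeAlgebra.induction k ι (motive := fun u => ∀ v, p v → p (u * v)) ?_ ?_ ?_ ?_ u
    · intro r v hv
      rw [← Algebra.smul_def]
      exact smul r v hv
    · exact fun i v hv => mul i v hv
    · intro a b ha hb v hv
      rw [mul_assoc]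
      exact ha _ (hb v hv)
    · intro a b ha hb v hv
      rw [add_mul]
      exact add _ _ (ha v hv) (hb v hv)
  simpa using key u 1 one

theorem mem_toSub {ι : Type*} {I : TwoSidedIdeal (T k ι)} {u : T k ι} : u ∈ toSub I ↔ u ∈ I :=
  Iff.rfl

theorem sum_comm₄ {ι M : Type*} [Fintype ι] [AddCommMonoid M] (H : ι → ι → ι → ι → M) :
    ∑ u, ∑ v, ∑ i, ∑ j, H u v i j = ∑ i, ∑ j, ∑ u, ∑ v, H u v i j := by
  have h : ∀ F : ι → ι → ι → ι → M, ∑ u, ∑ v, ∑ i, ∑ j, F u v i j =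
      ∑ x : ι × ι, ∑ y : ι × ι, F x.1 x.2 y.1 y.2 := fun F => by
    simp only [Fintype.sum_prod_type]
  rw [h, h fun i j u v => H u v i j, Finset.sum_comm]

theorem sum_comm₅ {ι M : Type*} [Fintype ι] [AddCommMonoid M]
    (H : ι → ι → ι → ι → ι → M) :
    ∑ i, ∑ j, ∑ r, ∑ o, ∑ n, H i j r o n = ∑ r, ∑ o, ∑ n, ∑ i, ∑ j, H i j r o n := by
  have h : ∀ F : ι → ι → ι → ι → ι → M, ∑ i, ∑ j, ∑ r, ∑ o, ∑ n, F i j r o n =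
      ∑ x : ι × ι × ι × ι × ι, F x.1 x.2.1 x.2.2.1 x.2.2.2.1 x.2.2.2.2 :=
    fun F => by simp only [Fintype.sum_prod_type]
  rw [h, h fun r o n i j => H i j r o n]
  exact Fintype.sum_equiv ⟨fun x => (x.2.2.1, x.2.2.2.1, x.2.2.2.2, x.1, x.2.1),
    fun y => (y.2.2.2.1, y.2.2.2.2, y.1, y.2.1, y.2.2.1),
    fun _ => rfl, fun _ => rfl⟩ _ _ fun _ => rfl

theorem sum_comm₆ {ι M : Type*} [Fintype ι] [AddCommMonoid M]
    (H : ι → ι → ι → ι → ι → ι → M) :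
    ∑ l, ∑ m, ∑ n, ∑ s, ∑ o, ∑ r, H l m n s o r =
      ∑ r, ∑ o, ∑ n, ∑ l, ∑ m, ∑ s, H l m n s o r := by
  have h : ∀ F : ι → ι → ι → ι → ι → ι → M, ∑ l, ∑ m, ∑ n, ∑ s, ∑ o, ∑ r, F l m n s o r =
      ∑ x : ι × ι × ι × ι × ι × ι, F x.1 x.2.1 x.2.2.1 x.2.2.2.1 x.2.2.2.2.1 x.2.2.2.2.2 :=
    fun F => by simp only [Fintype.sum_prod_type]
  rw [h, h fun r o n l m s => H l m n s o r]
  exact Fintype.sum_equiv ⟨fun x => (x.2.2.2.2.2, x.2.2.2.2.1, x.2.2.1, x.1, x.2.1, x.2.2.2.1),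
    fun y => (y.2.2.2.1, y.2.2.2.2.1, y.2.2.1, y.2.2.2.2.2, y.2.1, y.1),
    fun _ => rfl, fun _ => rfl⟩ _ _ fun _ => rfl

/-- The tensor `∑ f i j • (x_i ⊗ x_j)` is in the kernel of `1 + c`. -/
def InKer (B : Braiding k ι) (f : ι → ι → k) : Prop :=
  ∀ l m, f l m + ∑ i, ∑ j, f i j * B.coeff i j l m = 0

/-- The quadratic element of the tensor algebra with coefficients `f`. -/
noncomputable def quad (f : ι → ι → k) : T k ι :=
  ∑ i, ∑ j, f i j • (FreeAlgebra.ι k i * FreeAlgebra.ι k j)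

theorem InKer.sum_smul {B : Braiding k ι} {f : ι → ι → k} (hf : InKer B f) {M : Type*}
    [AddCommGroup M] [Module k M] (G : ι → ι → M) :
    ∑ u, ∑ v, f u v • G u v = -∑ i, ∑ j, f i j • ∑ u, ∑ v, B.coeff i j u v • G u v := by
  have h : ∀ u v, f u v • G u v = -∑ i, ∑ j, f i j • (B.coeff i j u v • G u v) := by
    intro u v
    rw [eq_neg_of_add_eq_zero_left (hf u v), neg_smul, Finset.sum_smul]
    simp only [Finset.sum_smul, mul_smul]
  simp only [h, Finset.sum_neg_distrib, Finset.smul_sum]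
  rw [sum_comm₄]

theorem InKer.sum_mul {B : Braiding k ι} {f : ι → ι → k} (hf : InKer B f) (G : ι → ι → k) :
    ∑ u, ∑ v, f u v * G u v = -∑ i, ∑ j, f i j * ∑ u, ∑ v, B.coeff i j u v * G u v :=
  hf.sum_smul G

/-- These are the coefficients left of x_n after c carries x_i rightwards across f. Substituting f =
-c(f) reduces the claim to the braid equation, which lets c on the two strands of f slide past the
strand of x_i. -/
theorem InKer.left {B : Braiding k ι} {f : ι → ι → k} (hf : InKer B f) (i n : ι) :
    InKer B fun d e => ∑ j, ∑ m, f j m * ∑ u, B.coeff i j d u * B.coeff u m e n := by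
  intro d e
  beta_reduce
  rw [hf.sum_mul fun j m => ∑ u, B.coeff i j d u * B.coeff u m e n, neg_add_eq_zero]
  simp only [Finset.sum_mul, mul_assoc]
  rw [sum_comm₄]
  refine Finset.sum_congr rfl fun j _ => Finset.sum_congr rfl fun m _ => ?_
  simp only [← Finset.mul_sum]
  rw [← B.braid]
  congr 1
  simp only [Finset.mul_sum]
  exact Finset.sum_congr rfl fun u _ => Finset.sum_comm

/-- The mirror image of `InKer.left`: here f itself is carried rightwards across x_q, and x_r comes
out on the left. -/
theorem InKer.right {B : Braiding k ι} {f : ι → ι → k} (hf : InKer B f) (q r : ι) :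
    InKer B fun o n => ∑ i, ∑ j, f i j * ∑ s, B.coeff j q s n * B.coeff i s r o := by
  intro d e
  beta_reduce
  rw [hf.sum_mul fun i j => ∑ s, B.coeff j q s e * B.coeff i s r d, neg_add_eq_zero]
  simp only [Finset.sum_mul, mul_assoc]
  rw [sum_comm₄]
  refine Finset.sum_congr rfl fun i _ => Finset.sum_congr rfl fun j _ => ?_
  simp only [← Finset.mul_sum]
  rw [B.braid]
  congr 1
  simp only [Finset.mul_sum]
  rw [Finset.sum_comm]
  conv_rhs => rw [Finset.sum_comm]
  exact Finset.sum_congr rfl fun v _ => Finset.sum_comm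

theorem extendEntry_one (B : Braiding k ι) (i j : ι) :
    extendEntry B i j 1 = if i = j then 1 else 0 := by
  simp [extendEntry, Matrix.one_apply]

theorem extendEntry_mul (B : Braiding k ι) (i j : ι) (u v : T k ι) :
    extendEntry B i j (u * v) = ∑ n, extendEntry B i n u * extendEntry B n j v := by
  simp [extendEntry, Matrix.mul_apply]

theorem extendEntry_ι (B : Braiding k ι) (i j m : ι) :
    extendEntry B i j (FreeAlgebra.ι k m) = ∑ l, B.coeff i m l j • FreeAlgebra.ι k l := by
  simp only [extendEntry, extend, LinearMap.comp_apply, AlgHom.toLinearMap_apply,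
    FreeAlgebra.lift_ι_apply, Matrix.entryLinearMap_apply, Matrix.of_apply]

theorem extendEntry_ι_mul (B : Braiding k ι) (i j m : ι) (u : T k ι) :
    extendEntry B i j (FreeAlgebra.ι k m * u) =
      ∑ n, ∑ l, B.coeff i m l n • (FreeAlgebra.ι k l * extendEntry B n j u) := by
  simp [extendEntry_mul, extendEntry_ι, Finset.sum_mul]

/-- The two-sided ideal generated by the kernel of `1 + c` on `V ⊗ V`. -/
noncomputable def kerIdeal (B : Braiding k ι) : TwoSidedIdeal (T k ι) :=
  TwoSidedIdeal.span {r | ∃ f, InKer B f ∧ r = quad f}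

theorem quad_mem_kerIdeal {B : Braiding k ι} {f : ι → ι → k} (hf : InKer B f) :
    quad f ∈ kerIdeal B :=
  TwoSidedIdeal.subset_span ⟨f, hf, rfl⟩

omit [DecidableEq ι] in
theorem quad_sum (f : ι → ι → k) (G : ι → ι → ι → ι → k) :
    quad (fun d e => ∑ j, ∑ m, f j m * G j m d e) = ∑ j, ∑ m, f j m • quad (G j m) := by
  simp only [quad, Finset.sum_smul, Finset.smul_sum, mul_smul]
  exact sum_comm₄ fun d e j m => f j m • G j m d e • (FreeAlgebra.ι k d * FreeAlgebra.ι k e)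

theorem extendEntry_quad (B : Braiding k ι) (f : ι → ι → k) (i n : ι) :
    extendEntry B i n (quad f) =
      quad fun d e => ∑ j, ∑ m, f j m * ∑ u, B.coeff i j d u * B.coeff u m e n := by
  rw [quad_sum]
  simp only [quad, map_sum, map_smul]
  refine Finset.sum_congr rfl fun j _ => Finset.sum_congr rfl fun m _ => ?_
  simp only [extendEntry_ι_mul, extendEntry_ι, Finset.mul_sum, Finset.smul_sum, Finset.sum_smul,
    mul_smul_comm, smul_smul]
  rw [Finset.sum_comm]
  exact Finset.sum_congr rfl fun l _ => Finset.sum_comm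

/-- On generators this is `InKer.left`; it passes to the ideal because `extend B` is multiplicative.
It makes I ⊗ T(V) stable under multiplication by Δ(x_i). -/
theorem extendEntry_mem {B : Braiding k ι} {u : T k ι} (hu : u ∈ kerIdeal B) (i j : ι) :
    extendEntry B i j u ∈ kerIdeal B := by
  refine TwoSidedIdeal.span_induction
    (p := fun u _ => ∀ i j, extendEntry B i j u ∈ kerIdeal B) ?_ ?_ ?_ ?_ ?_ ?_ hu i j
  · rintro _ ⟨f, hf, rfl⟩ i j
    rw [extendEntry_quad]
    exact quad_mem_kerIdeal (hf.left i j)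
  · intro i j
    rw [map_zero]
    exact zero_mem _
  · intro x y _ _ hx hy i j
    rw [map_add]
    exact add_mem (hx i j) (hy i j)
  · intro x _ hx i j
    rw [map_neg]
    exact neg_mem (hx i j)
  · intro a x _ hx i j
    rw [extendEntry_mul]
    exact sum_mem fun n _ => TwoSidedIdeal.mul_mem_left _ _ _ (hx n j)
  · intro a x _ hx i j
    rw [extendEntry_mul]
    exact sum_mem fun n _ => TwoSidedIdeal.mul_mem_right _ _ _ (hx i n)

/-- The action of `T(V)` on `T(V) ⊗ T(V)` by left multiplication through the comultiplication. -/
noncomputable def coact (B : Braiding k ι) : T k ι →ₐ[k] Module.End k (T k ι ⊗[k] T k ι) :=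
  FreeAlgebra.lift k (primitiveMul B)

theorem comul_apply (B : Braiding k ι) (u : T k ι) : comul B u = coact B u (1 ⊗ₜ[k] 1) := rfl

theorem primitiveMul_tmul (B : Braiding k ι) (i : ι) (u v : T k ι) :
    primitiveMul B i (u ⊗ₜ[k] v) = (FreeAlgebra.ι k i * u) ⊗ₜ[k] v +
      ∑ j, extendEntry B i j u ⊗ₜ[k] (FreeAlgebra.ι k j * v) := by
  simp [primitiveMul]

theorem comul_one (B : Braiding k ι) : comul B 1 = 1 ⊗ₜ[k] 1 := by
  simp [comul_apply]

theorem comul_ι_mul (B : Braiding k ι) (i : ι) (u : T k ι) :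
    comul B (FreeAlgebra.ι k i * u) = primitiveMul B i (comul B u) := by
  simp [comul_apply, coact]

theorem left_tmul_mem_coidealSub {ι : Type*} {I : TwoSidedIdeal (T k ι)} {u : T k ι} (hu : u ∈ I)
    (v : T k ι) : u ⊗ₜ[k] v ∈ coidealSub I :=
  Submodule.subset_span ⟨u, v, Or.inl hu, rfl⟩

theorem right_tmul_mem_coidealSub {ι : Type*} {I : TwoSidedIdeal (T k ι)} {v : T k ι} (hv : v ∈ I)
    (u : T k ι) : u ⊗ₜ[k] v ∈ coidealSub I :=
  Submodule.subset_span ⟨u, v, Or.inr hv, rfl⟩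

theorem primitiveMul_mem {B : Braiding k ι} (i : ι) {z : T k ι ⊗[k] T k ι}
    (hz : z ∈ coidealSub (kerIdeal B)) : primitiveMul B i z ∈ coidealSub (kerIdeal B) := by
  have : coidealSub (kerIdeal B) ≤ (coidealSub (kerIdeal B)).comap (primitiveMul B i) := by
    refine Submodule.span_le.2 ?_
    rintro _ ⟨u, v, h | h, rfl⟩
    · rw [SetLike.mem_coe, Submodule.mem_comap, primitiveMul_tmul]
      exact add_mem (left_tmul_mem_coidealSub (TwoSidedIdeal.mul_mem_left _ _ _ h) _)
        (sum_mem fun j _ => left_tmul_mem_coidealSub (extendEntry_mem h i j) _)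
    · rw [SetLike.mem_coe, Submodule.mem_comap, primitiveMul_tmul]
      exact add_mem (right_tmul_mem_coidealSub h _)
        (sum_mem fun j _ => right_tmul_mem_coidealSub (TwoSidedIdeal.mul_mem_left _ _ _ h) _)
  exact this hz

theorem coact_mem {B : Braiding k ι} (u : T k ι) {z : T k ι ⊗[k] T k ι}
    (hz : z ∈ coidealSub (kerIdeal B)) : coact B u z ∈ coidealSub (kerIdeal B) := by
  induction u using T_induction with
  | one => simpa using hz
  | mul i u hu =>
    rw [map_mul, Module.End.mul_apply, coact, FreeAlgebra.lift_ι_apply]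
    exact primitiveMul_mem i hu
  | add u v hu hv =>
    rw [map_add, LinearMap.add_apply]
    exact add_mem hu hv
  | smul r u hu =>
    rw [map_smul, LinearMap.smul_apply]
    exact Submodule.smul_mem _ r hu

/-- This is the part of Δ(f)(u ⊗ v) in which both letters of f cross u. By induction on the word u,
`InKer.right` moves f across one letter at a time, turning it into other elements of the kernel;
hence f has to vary in the induction. Once u is used up, f multiplies v on the left. -/
theorem extend_quad_tmul_mem {B : Braiding k ι} (u v : T k ι) {f : ι → ι → k}
    (hf : InKer B f) :
    ∑ i, ∑ j, f i j • ∑ l, ∑ m, extendEntry B i l (extendEntry B j m u) ⊗ₜ[k]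
      (FreeAlgebra.ι k l * (FreeAlgebra.ι k m * v)) ∈ coidealSub (kerIdeal B) := by
  induction u using T_induction generalizing f with
  | one =>
    simp only [extendEntry_one, apply_ite (extendEntry B _ _), map_zero]
    have : (1 : T k ι) ⊗ₜ[k] (quad f * v) ∈ coidealSub (kerIdeal B) :=
      right_tmul_mem_coidealSub (TwoSidedIdeal.mul_mem_right _ _ _ (quad_mem_kerIdeal hf)) _
    convert this using 1
    simp only [quad, Finset.sum_mul, TensorProduct.tmul_sum, smul_mul_assoc,
      TensorProduct.tmul_smul]
    refine Finset.sum_congr rfl fun i _ => Finset.sum_congr rfl fun j _ => ?_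
    congr 1
    rw [Finset.sum_eq_single i, Finset.sum_eq_single j]
    · simp [mul_assoc]
    all_goals simp +contextual [eq_comm]
  | mul q u hu =>
    set Φ : ι → ι → T k ι ⊗[k] T k ι := fun o n => ∑ l, ∑ m,
      extendEntry B o l (extendEntry B n m u) ⊗ₜ[k]
        (FreeAlgebra.ι k l * (FreeAlgebra.ι k m * v)) with hΦ
    let M : ι → T k ι ⊗[k] T k ι →ₗ[k] T k ι ⊗[k] T k ι := fun r =>
      TensorProduct.map (LinearMap.mulLeft k (FreeAlgebra.ι k r)) LinearMap.id
    have hM : ∀ r, ∀ z ∈ coidealSub (kerIdeal B), M r z ∈ coidealSub (kerIdeal B) := by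
      intro r
      refine (Submodule.span_le (p := (coidealSub (kerIdeal B)).comap (M r))).2 ?_
      rintro _ ⟨u, v, h | h, rfl⟩
      · exact left_tmul_mem_coidealSub (TwoSidedIdeal.mul_mem_left _ _ _ h) _
      · exact right_tmul_mem_coidealSub h _
    have key : ∀ i j, ∑ l, ∑ m, extendEntry B i l (extendEntry B j m (FreeAlgebra.ι k q * u)) ⊗ₜ[k]
        (FreeAlgebra.ι k l * (FreeAlgebra.ι k m * v)) =
        ∑ r, ∑ o, ∑ n, (∑ s, B.coeff j q s n * B.coeff i s r o) • M r (Φ o n) := by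
      intro i j
      simp only [hΦ, extendEntry_ι_mul, map_sum, map_smul, Finset.smul_sum, Finset.sum_smul,
        TensorProduct.sum_tmul, mul_smul, M, TensorProduct.map_tmul,
        LinearMap.mulLeft_apply, LinearMap.id_apply, ← TensorProduct.smul_tmul']
      exact sum_comm₆ fun l m n s o r => B.coeff j q s n • B.coeff i s r o •
        (FreeAlgebra.ι k r * extendEntry B o l (extendEntry B n m u)) ⊗ₜ[k]
          (FreeAlgebra.ι k l * (FreeAlgebra.ι k m * v))
    have : ∑ r, M r (∑ o, ∑ n, (∑ i, ∑ j, f i j * ∑ s, B.coeff j q s n * B.coeff i s r o) • Φ o n)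
        ∈ coidealSub (kerIdeal B) := sum_mem fun r _ => hM r _ (hu (hf.right q r))
    convert this using 1
    generalize hC : (fun i j r o n => ∑ s, B.coeff j q s n * B.coeff i s r o) = C at *
    simp only [funext_iff] at hC
    simp only [key, hC, map_sum, map_smul, Finset.sum_smul, smul_smul, Finset.smul_sum]
    exact sum_comm₅ fun i j r o n => (f i j * C i j r o n) • M r (Φ o n)
  | add u₁ u₂ h₁ h₂ =>
    simp only [map_add, TensorProduct.add_tmul, Finset.sum_add_distrib, smul_add]
    exact add_mem (h₁ hf) (h₂ hf)
  | smul r u hu =>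
    have := Submodule.smul_mem _ r (hu hf)
    simp only [Finset.smul_sum] at this
    simp only [map_smul, ← TensorProduct.smul_tmul', Finset.smul_sum]
    simpa only [smul_comm r] using this

/-- Primitivity of f: of the four kinds of terms in Δ(x_i)Δ(x_j), the two mixed ones cancel after
summation against f. -/
theorem coact_quad_mem {B : Braiding k ι} {f : ι → ι → k} (hf : InKer B f)
    (z : T k ι ⊗[k] T k ι) : coact B (quad f) z ∈ coidealSub (kerIdeal B) := by
  induction z using TensorProduct.induction_on with
  | zero =>
    rw [map_zero]
    exact zero_mem _
  | add x y hx hy =>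
    rw [map_add]
    exact add_mem hx hy
  | tmul u v =>
    have : coact B (quad f) (u ⊗ₜ[k] v) = (quad f * u) ⊗ₜ[k] v +
        ∑ i, ∑ j, f i j • ∑ l, ∑ m, extendEntry B i l (extendEntry B j m u) ⊗ₜ[k]
          (FreeAlgebra.ι k l * (FreeAlgebra.ι k m * v)) := by
      -- `G l m` is the mixed term with x_l kept in the left factor and x_m carried across u. If
      -- instead x_i is the letter carried to the right, it must also cross x_j, which yields the
      -- sum of `B.coeff i j l m • G l m`.
      set G : ι → ι → T k ι ⊗[k] T k ι := fun l m => ∑ n,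
        (FreeAlgebra.ι k l * extendEntry B m n u) ⊗ₜ[k] (FreeAlgebra.ι k n * v) with hG
      have h1 : ∀ i j, coact B (FreeAlgebra.ι k i * FreeAlgebra.ι k j) (u ⊗ₜ[k] v) =
          (FreeAlgebra.ι k i * FreeAlgebra.ι k j * u) ⊗ₜ[k] v +
          (G i j + ∑ l, ∑ m, B.coeff i j l m • G l m +
          ∑ l, ∑ m, extendEntry B i l (extendEntry B j m u) ⊗ₜ[k]
          (FreeAlgebra.ι k l * (FreeAlgebra.ι k m * v))) := by
        intro i j
        simp only [coact, map_mul, FreeAlgebra.lift_ι_apply, Module.End.mul_apply,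
          primitiveMul_tmul, map_add, map_sum, extendEntry_ι_mul, Finset.sum_add_distrib, hG,
          TensorProduct.sum_tmul, Finset.smul_sum, ← TensorProduct.smul_tmul', mul_assoc]
        have e1 : ∀ F : ι → ι → ι → T k ι ⊗[k] T k ι,
            ∑ x, ∑ m, ∑ l, F l m x = ∑ l, ∑ m, ∑ n, F l m n := by
          exact fun F => (Finset.sum_congr rfl fun x _ => Finset.sum_comm).trans
            (Finset.sum_comm.trans (Finset.sum_congr rfl fun l _ => Finset.sum_comm))
        rw [e1 fun l m n => B.coeff i j l m • (FreeAlgebra.ι k l * extendEntry B m n u) ⊗ₜ[k]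
          (FreeAlgebra.ι k n * v), Finset.sum_comm (f := fun x y => extendEntry B i y
            (extendEntry B j x u) ⊗ₜ[k] (FreeAlgebra.ι k y * (FreeAlgebra.ι k x * v)))]
        abel
      have h2 := hf.sum_smul G
      simp only [quad, map_sum, map_smul, LinearMap.sum_apply, LinearMap.smul_apply, h1,
        smul_add, Finset.sum_add_distrib, h2, Finset.sum_mul, TensorProduct.sum_tmul,
        smul_mul_assoc, ← TensorProduct.smul_tmul']
      abel
    rw [this]
    exact add_mem (left_tmul_mem_coidealSub
      (TwoSidedIdeal.mul_mem_right _ _ _ (quad_mem_kerIdeal hf)) _)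
      (extend_quad_tmul_mem u v hf)

theorem coact_mem_of_mem {B : Braiding k ι} {u : T k ι} (hu : u ∈ kerIdeal B)
    (z : T k ι ⊗[k] T k ι) : coact B u z ∈ coidealSub (kerIdeal B) := by
  refine TwoSidedIdeal.span_induction
    (p := fun u _ => ∀ z, coact B u z ∈ coidealSub (kerIdeal B)) ?_ ?_ ?_ ?_ ?_ ?_ hu z
  · rintro _ ⟨f, hf, rfl⟩ z
    exact coact_quad_mem hf z
  · intro z
    rw [map_zero]
    exact zero_mem _
  · intro x y _ _ hx hy z
    rw [map_add]
    exact add_mem (hx z) (hy z)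
  · intro x _ hx z
    rw [map_neg]
    exact neg_mem (hx z)
  · intro a x _ hx z
    rw [map_mul]
    exact coact_mem a (hx z)
  · intro a x _ hx z
    rw [map_mul]
    exact hx _

theorem mul_mem_deg {ι : Type*} {m n : ℕ} {u v : T k ι} (hu : u ∈ deg k ι m)
    (hv : v ∈ deg k ι n) : u * v ∈ deg k ι (m + n) := by
  have : deg k ι m * deg k ι n ≤ deg k ι (m + n) := by
    rw [deg, deg, Submodule.span_mul_span, Submodule.span_le]
    rintro _ ⟨_, ⟨l, rfl, rfl⟩, _, ⟨l', rfl, rfl⟩, rfl⟩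
    exact Submodule.subset_span ⟨l ++ l', by simp, by simp⟩
  exact this (Submodule.mul_mem_mul hu hv)

theorem ι_mem_deg {ι : Type*} (i : ι) : FreeAlgebra.ι k i ∈ deg k ι 1 :=
  Submodule.subset_span ⟨[i], by simp, by simp⟩

theorem one_mem_deg (k ι : Type*) [Field k] : (1 : T k ι) ∈ deg k ι 0 :=
  Submodule.subset_span ⟨[], by simp, by simp⟩

theorem mem_iSup_deg {ι : Type*} (u : T k ι) : u ∈ ⨆ n, deg k ι n := by
  induction u using T_induction with
  | one => exact Submodule.mem_iSup_of_mem 0 (one_mem_deg k ι)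
  | mul i u hu =>
    have : (⨆ n, deg k ι n) ≤ (⨆ n, deg k ι n).comap
        (LinearMap.mulLeft k (FreeAlgebra.ι k i)) :=
      iSup_le fun n v hv => Submodule.mem_iSup_of_mem (1 + n) (mul_mem_deg (ι_mem_deg i) hv)
    exact this hu
  | add u v hu hv => exact add_mem hu hv
  | smul r u hu => exact Submodule.smul_mem _ r hu

omit [DecidableEq ι] in
theorem quad_mem_deg (f : ι → ι → k) : quad f ∈ deg k ι 2 :=
  Submodule.sum_mem _ fun i _ => Submodule.sum_mem _ fun j _ => Submodule.smul_mem _ _ <| by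
    simpa using mul_mem_deg (ι_mem_deg (k := k) i) (ι_mem_deg j)

theorem span_homogeneous {ι : Type*} {S : Set (T k ι)} (hS : S ⊆ deg k ι 2) :
    toSub (TwoSidedIdeal.span S) ≤ ⨆ n ≥ 2, toSub (TwoSidedIdeal.span S) ⊓ deg k ι n := by
  set I := TwoSidedIdeal.span S
  intro u hu
  refine TwoSidedIdeal.span_induction
    (p := fun u _ => u ∈ ⨆ n ≥ 2, toSub I ⊓ deg k ι n) ?_ ?_ ?_ ?_ ?_ ?_ hu
  · exact fun r hr => Submodule.mem_iSup_of_mem 2 <| Submodule.mem_iSup_of_mem le_rfl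
      ⟨TwoSidedIdeal.subset_span hr, hS hr⟩
  · exact zero_mem _
  · exact fun x y _ _ hx hy => add_mem hx hy
  · exact fun x _ hx => neg_mem hx
  · intro a x _ hx
    have h1 : ∀ n ≥ 2, ∀ y ∈ toSub I ⊓ deg k ι n, (⨆ n, deg k ι n) ≤
        (⨆ n ≥ 2, toSub I ⊓ deg k ι n).comap (LinearMap.mulRight k y) :=
      fun n hn y hy => iSup_le fun m b hb => Submodule.mem_iSup_of_mem (m + n) <|
        Submodule.mem_iSup_of_mem (by omega)
          ⟨I.mul_mem_left _ _ hy.1, mul_mem_deg hb hy.2⟩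
    have h2 : (⨆ n ≥ 2, toSub I ⊓ deg k ι n) ≤
        (⨆ n ≥ 2, toSub I ⊓ deg k ι n).comap (LinearMap.mulLeft k a) :=
      iSup₂_le fun n hn y hy => h1 n hn y hy (mem_iSup_deg a)
    exact h2 hx
  · intro a x _ hx
    have h1 : ∀ n ≥ 2, ∀ y ∈ toSub I ⊓ deg k ι n, (⨆ n, deg k ι n) ≤
        (⨆ n ≥ 2, toSub I ⊓ deg k ι n).comap (LinearMap.mulLeft k y) :=
      fun n hn y hy => iSup_le fun m b hb => Submodule.mem_iSup_of_mem (n + m) <|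
        Submodule.mem_iSup_of_mem (by omega)
          ⟨I.mul_mem_right _ _ hy.1, mul_mem_deg hy.2 hb⟩
    have h2 : (⨆ n ≥ 2, toSub I ⊓ deg k ι n) ≤
        (⨆ n ≥ 2, toSub I ⊓ deg k ι n).comap (LinearMap.mulRight k a) :=
      iSup₂_le fun n hn y hy => h1 n hn y hy (mem_iSup_deg a)
    exact h2 hx

theorem kerIdeal_isHopfIdeal (B : Braiding k ι) : IsHopfIdeal B (kerIdeal B) where
  homogeneous := span_homogeneous (by
    rintro _ ⟨f, -, rfl⟩
    exact quad_mem_deg f)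
  coideal u hu := coact_mem_of_mem hu _

theorem quad_mem_nicholsIdeal {B : Braiding k ι} {f : ι → ι → k} (hf : InKer B f) :
    quad f ∈ nicholsIdeal B :=
  (nicholsIdeal_isGreatest B).2 (kerIdeal_isHopfIdeal B) (quad_mem_kerIdeal hf)

end General

end BraidedRank

namespace BraidedRank

/-! ### Skew derivations and the degree two part of the ideal. -/

section Derivations

variable {k ι : Type*} [Field k]

/-- The counit of the tensor algebra. -/
noncomputable def counit (k ι : Type*) [Field k] : T k ι →ₐ[k] k := FreeAlgebra.lift k fun _ => 0

@[simp] theorem counit_ι (i : ι) : counit k ι (FreeAlgebra.ι k i) = 0 := by simp [counit]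

variable [DecidableEq ι]

/-- The coefficient of the generator `x_l`. -/
noncomputable def linCoeff (k : Type*) [Field k] (l : ι) : T k ι →ₗ[k] k :=
  (TrivSqZeroExt.sndHom k k).restrictScalars k ∘ₗ
    (FreeAlgebra.lift k (A := TrivSqZeroExt k k)
      fun i => TrivSqZeroExt.inr (if i = l then 1 else 0)).toLinearMap

@[simp] theorem linCoeff_one (l : ι) : linCoeff k l 1 = 0 := by simp [linCoeff]

omit [DecidableEq ι] in
theorem fst_lift_inr (g : ι → k) (u : T k ι) :
    (FreeAlgebra.lift k (A := TrivSqZeroExt k k) (fun i => TrivSqZeroExt.inr (g i)) u).fst =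
      counit k ι u := by
  have : (TrivSqZeroExt.fstHom k k k).comp (FreeAlgebra.lift k (A := TrivSqZeroExt k k)
      fun i => TrivSqZeroExt.inr (g i)) = counit k ι := by
    ext i
    simp
  exact DFunLike.congr_fun this u

@[simp] theorem linCoeff_ι_mul (l i : ι) (u : T k ι) :
    linCoeff k l (FreeAlgebra.ι k i * u) = if i = l then counit k ι u else 0 := by
  have h := fst_lift_inr (fun i => if i = l then (1 : k) else 0) u
  simp only [linCoeff, LinearMap.comp_apply, AlgHom.toLinearMap_apply, map_mul,
    FreeAlgebra.lift_ι_apply, LinearMap.coe_restrictScalars, TrivSqZeroExt.sndHom_apply,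
    TrivSqZeroExt.snd_mul, TrivSqZeroExt.fst_inr, TrivSqZeroExt.snd_inr, h]
  simp

theorem linCoeff_eq_zero_of_mem_deg {n : ℕ} (hn : 2 ≤ n) (l : ι) {u : T k ι}
    (hu : u ∈ deg k ι n) : linCoeff k l u = 0 := by
  refine (Submodule.span_le (p := LinearMap.ker (linCoeff k l))).2 ?_ hu
  rintro _ ⟨w, rfl, rfl⟩
  match w, hn with
  | i :: j :: w, _ => simp

omit [DecidableEq ι] in
theorem counit_eq_zero_of_mem_deg {n : ℕ} (hn : 2 ≤ n) {u : T k ι}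
    (hu : u ∈ deg k ι n) : counit k ι u = 0 := by
  refine (Submodule.span_le (p := LinearMap.ker (counit k ι).toLinearMap)).2 ?_ hu
  rintro _ ⟨w, rfl, rfl⟩
  match w, hn with
  | i :: j :: w, _ => simp

variable [Fintype ι]

theorem linCoeff_eq_zero {B : Braiding k ι} (l : ι) {u : T k ι} (hu : u ∈ nicholsIdeal B) :
    linCoeff k l u = 0 := by
  have h := (nicholsIdeal_isGreatest B).1.homogeneous hu
  refine (iSup₂_le (a := LinearMap.ker (linCoeff k l)) fun n hn v hv => ?_) h
  exact linCoeff_eq_zero_of_mem_deg hn l hv.2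

theorem counit_eq_zero {B : Braiding k ι} {u : T k ι} (hu : u ∈ nicholsIdeal B) :
    counit k ι u = 0 := by
  have h := (nicholsIdeal_isGreatest B).1.homogeneous hu
  refine (iSup₂_le (a := LinearMap.ker (counit k ι).toLinearMap) fun n hn v hv => ?_) h
  exact counit_eq_zero_of_mem_deg hn hv.2

theorem counit_extendEntry (B : Braiding k ι) (i j : ι) (u : T k ι) :
    counit k ι (extendEntry B i j u) = if i = j then counit k ι u else 0 := by
  induction u using T_induction generalizing i j with
  | one => simp [extendEntry_one, apply_ite (counit k ι)]
  | mul q u hu => simp [extendEntry_ι_mul]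
  | add u v hu hv => simp only [map_add, hu, hv]; split_ifs <;> simp
  | smul r u hu => simp [hu]

theorem linCoeff_extendEntry (B : Braiding k ι) (i j l : ι) (u : T k ι) :
    linCoeff k l (extendEntry B i j u) = ∑ m, B.coeff i m l j * linCoeff k m u := by
  induction u using T_induction generalizing i j with
  | one => simp [extendEntry_one, apply_ite (linCoeff k l)]
  | mul q u hu => simp [extendEntry_ι_mul, counit_extendEntry]
  | add u v hu hv => simp [hu, hv, mul_add, Finset.sum_add_distrib]
  | smul r u hu => simp [hu, Finset.mul_sum, mul_left_comm]

/-- Contraction of the first tensor factor with a linear functional. -/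
noncomputable def contract (φ : T k ι →ₗ[k] k) : T k ι ⊗[k] T k ι →ₗ[k] T k ι :=
  (TensorProduct.lid k (T k ι)).toLinearMap ∘ₗ TensorProduct.map φ LinearMap.id

omit [DecidableEq ι] [Fintype ι] in
@[simp] theorem contract_tmul (φ : T k ι →ₗ[k] k) (u v : T k ι) :
    contract φ (u ⊗ₜ[k] v) = φ u • v := by simp [contract]

theorem contract_counit_primitiveMul (B : Braiding k ι) (i : ι) (z : T k ι ⊗[k] T k ι) :
    contract (counit k ι).toLinearMap (primitiveMul B i z) =
      FreeAlgebra.ι k i * contract (counit k ι).toLinearMap z := by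
  induction z using TensorProduct.induction_on with
  | zero => simp
  | add x y hx hy => rw [map_add, map_add, map_add, hx, hy, mul_add]
  | tmul u v => simp [primitiveMul_tmul, counit_extendEntry]

/-- The left counit axiom; it identifies the undifferentiated term u in the Leibniz rule
`der_ι_mul`. -/
theorem contract_counit_comul (B : Braiding k ι) (u : T k ι) :
    contract (counit k ι).toLinearMap (comul B u) = u := by
  induction u using T_induction with
  | one => simp [comul_one]
  | mul i u hu => rw [comul_ι_mul, contract_counit_primitiveMul, hu]
  | add u v hu hv => rw [map_add, map_add, hu, hv]
  | smul r u hu => rw [map_smul, map_smul, hu]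

/-- The skew derivation `∂_l` of the tensor algebra: `Δ u` is `∑ l, x_l ⊗ ∂_l u` up to terms whose
first tensor factor is not of degree one. -/
noncomputable def der (B : Braiding k ι) (l : ι) : T k ι →ₗ[k] T k ι :=
  contract (linCoeff k l) ∘ₗ comul B

theorem der_one (B : Braiding k ι) (l : ι) : der B l 1 = 0 := by
  simp [der, comul_one]

/-- The summand x_i ⊗ 1 of Δ(x_i) contributes to the linear part of the first factor only through
the counit, whereas 1 ⊗ x_i has to be braided past the linear part of the first factor of Δ(u). -/
theorem der_ι_mul (B : Braiding k ι) (l i : ι) (u : T k ι) :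
    der B l (FreeAlgebra.ι k i * u) = (if i = l then u else 0) +
      ∑ j, ∑ m, B.coeff i m l j • (FreeAlgebra.ι k j * der B m u) := by
  have h : ∀ z, contract (linCoeff k l) (primitiveMul B i z) =
      (if i = l then contract (counit k ι).toLinearMap z else 0) +
      ∑ j, ∑ m, B.coeff i m l j • (FreeAlgebra.ι k j * contract (linCoeff k m) z) := by
    intro z
    induction z using TensorProduct.induction_on with
    | zero => simp
    | add x y hx hy =>
      simp only [map_add, hx, hy, mul_add, smul_add, Finset.sum_add_distrib]
      split_ifs <;> abel
    | tmul u v =>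
      simp [primitiveMul_tmul, linCoeff_extendEntry, Finset.sum_smul, mul_smul, ite_smul]
  simp only [der, LinearMap.comp_apply, comul_ι_mul, h, contract_counit_comul]

/-- The coproduct of u lies in J ⊗ T(V) + T(V) ⊗ J. The contraction kills the first summand, as J
starts in degree two, and sends the second one into J. -/
theorem der_mem {B : Braiding k ι} (l : ι) {u : T k ι} (hu : u ∈ nicholsIdeal B) :
    der B l u ∈ nicholsIdeal B := by
  refine (Submodule.span_le (p := (toSub (nicholsIdeal B)).comap (contract (linCoeff k l)))).2 ?_
    ((nicholsIdeal_isGreatest B).1.coideal u hu)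
  rintro _ ⟨u, v, h | h, rfl⟩
  · simp [linCoeff_eq_zero l h]
  · simpa using Submodule.smul_mem _ _ (mem_toSub.2 h)

/-- The coefficient of x_m in ∂_l of `quad f` is the (l, m) coefficient of (1 + c)f, and it vanishes
because ∂_l preserves J. -/
theorem inKer_of_quad_mem {B : Braiding k ι} {f : ι → ι → k} (hf : quad f ∈ nicholsIdeal B) :
    InKer B f := by
  intro l m
  have h := linCoeff_eq_zero m (der_mem l hf)
  rw [← h]
  have h1 : ∀ i, der B i 1 = 0 := der_one B
  have h2 : ∀ i j, der B i (FreeAlgebra.ι k j) = if j = i then 1 else 0 := fun i j => by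
    simpa [der_one] using der_ι_mul B i j 1
  have h3 : ∀ i j : ι, linCoeff k i (FreeAlgebra.ι k j) = if j = i then 1 else 0 := fun i j => by
    simpa [eq_comm] using linCoeff_ι_mul (k := k) (i : ι) j 1
  simp only [quad, map_sum, map_smul, der_ι_mul, h2, map_add, apply_ite (linCoeff k m), map_zero,
    linCoeff_ι_mul, h3, smul_eq_mul, mul_add, Finset.sum_add_distrib]
  simp

theorem exists_quad_of_mem_deg {u : T k ι} (hu : u ∈ deg k ι 2) : ∃ f, u = quad f := by
  let Q : (ι → ι → k) →ₗ[k] T k ι :=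
    { toFun := quad
      map_add' := fun f g => by simp [quad, add_smul, Finset.sum_add_distrib]
      map_smul' := fun r f => by simp [quad, mul_smul, Finset.smul_sum] }
  have : deg k ι 2 ≤ LinearMap.range Q := by
    refine Submodule.span_le.2 ?_
    rintro _ ⟨w, hw, rfl⟩
    obtain ⟨i, j, rfl⟩ := List.length_eq_two.1 hw
    refine ⟨fun a b => if a = i then if b = j then 1 else 0 else 0, ?_⟩
    change quad _ = _
    simp [quad, ite_smul]
  obtain ⟨f, hf⟩ := this hu
  exact ⟨f, hf.symm⟩

theorem quadraticRelations_eq_bot {B : Braiding k ι} (h : ∀ f, InKer B f → f = 0) :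
    quadraticRelations B = ⊥ := by
  rw [eq_bot_iff]
  rintro u ⟨hu, hd⟩
  obtain ⟨f, rfl⟩ := exists_quad_of_mem_deg hd
  rw [h f (inKer_of_quad_mem hu)]
  simp [quad]

end Derivations

end BraidedRank

namespace BraidedRank

/-! ### Derivations and quadratic relations for R_{1,4}. -/

section Derivations14

variable {k : Type*} [Field k]

/-- The generators of the tensor algebra in rank three. -/
noncomputable abbrev gen (k : Type*) [Field k] (i : Fin 3) : T k (Fin 3) := FreeAlgebra.ι k i

variable {t a b p : k} {ht : t ≠ 0}

theorem der14_zero_gen_zero (u : T k (Fin 3)) :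
    der (braiding14 t a b p ht) 0 (gen k 0 * u) = u +
      t • (gen k 0 * der (braiding14 t a b p ht) 0 u) -
      (t * a) • (gen k 0 * der (braiding14 t a b p ht) 2 u) := by
  simp [der_ι_mul, braiding14, r14, R14, Fin.sum_univ_three, finProdFinEquiv]
  abel

theorem der14_one_gen_zero (u : T k (Fin 3)) :
    der (braiding14 t a b p ht) 1 (gen k 0 * u) =
      t • (gen k 0 * der (braiding14 t a b p ht) 1 u) := by
  simp [der_ι_mul, braiding14, r14, R14, Fin.sum_univ_three, finProdFinEquiv]

theorem der14_two_gen_zero (u : T k (Fin 3)) :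
    der (braiding14 t a b p ht) 2 (gen k 0 * u) =
      t • (gen k 0 * der (braiding14 t a b p ht) 2 u) := by
  simp [der_ι_mul, braiding14, r14, R14, Fin.sum_univ_three, finProdFinEquiv]

theorem der14_one_gen_one (u : T k (Fin 3)) :
    der (braiding14 t a b p ht) 1 (gen k 1 * u) = u +
      t • (gen k 1 * der (braiding14 t a b p ht) 1 u) := by
  simp [der_ι_mul, braiding14, r14, R14, Fin.sum_univ_three, finProdFinEquiv]

theorem der14_two_gen_one (u : T k (Fin 3)) :
    der (braiding14 t a b p ht) 2 (gen k 1 * u) =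
      t • (gen k 1 * der (braiding14 t a b p ht) 2 u) := by
  simp [der_ι_mul, braiding14, r14, R14, Fin.sum_univ_three, finProdFinEquiv]

theorem der14_zero_gen_two (u : T k (Fin 3)) :
    der (braiding14 t a b p ht) 0 (gen k 2 * u) =
      t • (gen k 2 * der (braiding14 t a b p ht) 0 u) +
      (t * a) • (gen k 0 * der (braiding14 t a b p ht) 0 u) -
      (t * b) • (gen k 2 * der (braiding14 t a b p ht) 2 u) +
      (t * p) • (gen k 1 * der (braiding14 t a b p ht) 2 u) -
      (t * a * b) • (gen k 0 * der (braiding14 t a b p ht) 2 u) := by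
  simp [der_ι_mul, braiding14, r14, R14, Fin.sum_univ_three, finProdFinEquiv]
  abel

theorem der14_one_gen_two (u : T k (Fin 3)) :
    der (braiding14 t a b p ht) 1 (gen k 2 * u) =
      t • (gen k 2 * der (braiding14 t a b p ht) 1 u) +
      (t * (2 * b - a)) • (gen k 0 * der (braiding14 t a b p ht) 1 u) := by
  simp [der_ι_mul, braiding14, r14, R14, Fin.sum_univ_three, finProdFinEquiv]
  abel

theorem der14_two_gen_two (u : T k (Fin 3)) :
    der (braiding14 t a b p ht) 2 (gen k 2 * u) = u +
      t • (gen k 2 * der (braiding14 t a b p ht) 2 u) +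
      (t * b) • (gen k 0 * der (braiding14 t a b p ht) 2 u) := by
  simp [der_ι_mul, braiding14, r14, R14, Fin.sum_univ_three, finProdFinEquiv]
  abel

theorem inKer_braiding14_iff (f : Fin 3 → Fin 3 → k) :
    InKer (braiding14 t a b p ht) f ↔
      f 0 0 + t * (f 0 0 + a * f 2 0 - a * f 0 2 - a * b * f 2 2) = 0 ∧
      f 0 1 + t * (f 1 0 + (a - 2 * b) * f 1 2 + p * f 2 2) = 0 ∧
      f 0 2 + t * (f 2 0 - b * f 2 2) = 0 ∧
      f 1 0 + t * (f 0 1 + (2 * b - a) * f 2 1) = 0 ∧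
      f 1 1 + t * f 1 1 = 0 ∧ f 1 2 + t * f 2 1 = 0 ∧
      f 2 0 + t * (f 0 2 + b * f 2 2) = 0 ∧ f 2 1 + t * f 1 2 = 0 ∧
      f 2 2 + t * f 2 2 = 0 := by
  simp [InKer, Fin.forall_fin_succ, Fin.sum_univ_three, braiding14, r14, R14, finProdFinEquiv]
  constructor
  · rintro ⟨⟨h1, h2, h3⟩, ⟨h4, h5, h6⟩, h7, h8, h9⟩
    refine ⟨?_, ?_, ?_, ?_, ?_, ?_, ?_, ?_, ?_⟩
    exacts [by linear_combination h1, by linear_combination h2, by linear_combination h3,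
      by linear_combination h4, by linear_combination h5, by linear_combination h6,
      by linear_combination h7, by linear_combination h8, by linear_combination h9]
  · rintro ⟨h1, h2, h3, h4, h5, h6, h7, h8, h9⟩
    refine ⟨⟨?_, ?_, ?_⟩, ⟨?_, ?_, ?_⟩, ?_, ?_, ?_⟩
    exacts [by linear_combination h1, by linear_combination h2, by linear_combination h3,
      by linear_combination h4, by linear_combination h5, by linear_combination h6,
      by linear_combination h7, by linear_combination h8, by linear_combination h9]

/-- The braiding is t times the flip up to terms with fewer letters x_3. Solving from the
coefficients with most x_3 downwards, each diagonal unknown has factor 1 + t and each symmetric pair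
has determinant 1 - t^2. -/
theorem eq_zero_of_inKer_braiding14 (ht2 : t ^ 2 ≠ 1) {f : Fin 3 → Fin 3 → k}
    (hf : InKer (braiding14 t a b p ht) f) : f = 0 := by
  obtain ⟨h1, h2, h3, h4, h5, h6, h7, h8, h9⟩ := (inKer_braiding14_iff f).1 hf
  have hp : 1 + t ≠ 0 := fun h => ht2 (by linear_combination (t - 1) * h)
  have hd : 1 - t ^ 2 ≠ 0 := fun h => ht2 (by linear_combination -h)
  have e22 : f 2 2 = 0 := (mul_eq_zero.1 (by linear_combination h9 :
    (1 + t) * f 2 2 = 0)).resolve_left hp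
  have e11 : f 1 1 = 0 := (mul_eq_zero.1 (by linear_combination h5 :
    (1 + t) * f 1 1 = 0)).resolve_left hp
  have e12 : f 1 2 = 0 := (mul_eq_zero.1 (by linear_combination h6 - t * h8 :
    (1 - t ^ 2) * f 1 2 = 0)).resolve_left hd
  have e21 : f 2 1 = 0 := (mul_eq_zero.1 (by linear_combination h8 - t * h6 :
    (1 - t ^ 2) * f 2 1 = 0)).resolve_left hd
  rw [e22] at h1 h2 h3 h7
  rw [e12] at h2
  rw [e21] at h4
  have e02 : f 0 2 = 0 := (mul_eq_zero.1 (by linear_combination h3 - t * h7 :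
    (1 - t ^ 2) * f 0 2 = 0)).resolve_left hd
  have e20 : f 2 0 = 0 := (mul_eq_zero.1 (by linear_combination h7 - t * h3 :
    (1 - t ^ 2) * f 2 0 = 0)).resolve_left hd
  have e01 : f 0 1 = 0 := (mul_eq_zero.1 (by linear_combination h2 - t * h4 :
    (1 - t ^ 2) * f 0 1 = 0)).resolve_left hd
  have e10 : f 1 0 = 0 := (mul_eq_zero.1 (by linear_combination h4 - t * h2 :
    (1 - t ^ 2) * f 1 0 = 0)).resolve_left hd
  rw [e02, e20] at h1
  have e00 : f 0 0 = 0 := (mul_eq_zero.1 (by linear_combination h1 :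
    (1 + t) * f 0 0 = 0)).resolve_left hp
  funext i j
  fin_cases i <;> fin_cases j <;> assumption

theorem mem_nicholsIdeal_braiding14 (f : Fin 3 → Fin 3 → k)
    (hf : InKer (braiding14 t a b p ht) f) {u : T k (Fin 3)} (hu : u = quad f) :
    u ∈ nicholsIdeal (braiding14 t a b p ht) :=
  hu ▸ quad_mem_nicholsIdeal hf

/-- The relations of the Nichols algebra for `t = 1`. -/
def relSym (a b : k) : Set (T k (Fin 3)) :=
  {gen k 1 * gen k 0 - gen k 0 * gen k 1,
    gen k 2 * gen k 0 - gen k 0 * gen k 2 - a • gen k 0 ^ 2,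
    gen k 2 * gen k 1 - gen k 1 * gen k 2 + (a - 2 * b) • (gen k 0 * gen k 1)}

/-- The relations of the Nichols algebra for `t = -1` and `p ≠ 0`. -/
def relExt (a b : k) : Set (T k (Fin 3)) :=
  {gen k 1 * gen k 0 + gen k 0 * gen k 1,
    gen k 2 * gen k 0 + gen k 0 * gen k 2,
    gen k 2 * gen k 1 + gen k 1 * gen k 2 + (a - 2 * b) • (gen k 0 * gen k 1),
    gen k 0 ^ 2, gen k 1 ^ 2}

/-- The relations of the Nichols algebra for `t = -1` and `p = 0`. -/
def relFin (a b : k) : Set (T k (Fin 3)) :=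
  {gen k 1 * gen k 0 + gen k 0 * gen k 1,
    gen k 2 * gen k 0 + gen k 0 * gen k 2,
    gen k 2 * gen k 1 + gen k 1 * gen k 2 + (a - 2 * b) • (gen k 0 * gen k 1),
    gen k 0 ^ 2, gen k 1 ^ 2, gen k 2 ^ 2 - b • (gen k 0 * gen k 2)}

theorem relSym_subset (h1 : t = 1) :
    relSym a b ⊆ nicholsIdeal (braiding14 t a b p ht) := by
  rintro u (rfl | rfl | rfl)
  · refine mem_nicholsIdeal_braiding14 ![![0, -1, 0], ![1, 0, 0], ![0, 0, 0]]
      ((inKer_braiding14_iff _).2 ?_) ?_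
    · simp [h1]
    · simp [quad, Fin.sum_univ_three]
      abel
  · refine mem_nicholsIdeal_braiding14 ![![-a, 0, -1], ![0, 0, 0], ![1, 0, 0]]
      ((inKer_braiding14_iff _).2 ?_) ?_
    · simp [h1]
    · simp [quad, Fin.sum_univ_three, pow_two]
      abel
  · refine mem_nicholsIdeal_braiding14 ![![0, a - 2 * b, 0], ![0, 0, -1], ![0, 1, 0]]
      ((inKer_braiding14_iff _).2 ?_) ?_
    · simp [h1]
    · simp [quad, Fin.sum_univ_three]
      abel

theorem relExt_subset (h1 : t = -1) :
    relExt a b ⊆ nicholsIdeal (braiding14 t a b p ht) := by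
  rintro u (rfl | rfl | rfl | rfl | rfl)
  · refine mem_nicholsIdeal_braiding14 ![![0, 1, 0], ![1, 0, 0], ![0, 0, 0]]
      ((inKer_braiding14_iff _).2 ?_) ?_
    · simp [h1]
    · simp [quad, Fin.sum_univ_three]
      abel
  · refine mem_nicholsIdeal_braiding14 ![![0, 0, 1], ![0, 0, 0], ![1, 0, 0]]
      ((inKer_braiding14_iff _).2 ?_) ?_
    · simp [h1]
    · simp [quad, Fin.sum_univ_three]
      abel
  · refine mem_nicholsIdeal_braiding14 ![![0, a - 2 * b, 0], ![0, 0, 1], ![0, 1, 0]]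
      ((inKer_braiding14_iff _).2 ?_) ?_
    · simp [h1]
    · simp [quad, Fin.sum_univ_three]
      abel
  · refine mem_nicholsIdeal_braiding14 ![![1, 0, 0], ![0, 0, 0], ![0, 0, 0]]
      ((inKer_braiding14_iff _).2 ?_) ?_
    · simp [h1]
    · simp [quad, Fin.sum_univ_three, pow_two]
  · refine mem_nicholsIdeal_braiding14 ![![0, 0, 0], ![0, 1, 0], ![0, 0, 0]]
      ((inKer_braiding14_iff _).2 ?_) ?_
    · simp [h1]
    · simp [quad, Fin.sum_univ_three, pow_two]

/-- Only the sixth relation is new. Its coefficient at x_1 ⊗ x_2 in (1 + c)f is t p, so p = 0 is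
what makes it a relation. -/
theorem relFin_subset (h1 : t = -1) (hp : p = 0) :
    relFin a b ⊆ nicholsIdeal (braiding14 t a b p ht) := by
  have h := relExt_subset (a := a) (b := b) (p := p) (ht := ht) h1
  rintro u (rfl | rfl | rfl | rfl | rfl | rfl)
  iterate 5 exact h (by simp [relExt])
  refine mem_nicholsIdeal_braiding14 ![![0, 0, -b], ![0, 0, 0], ![0, 0, 1]]
    ((inKer_braiding14_iff _).2 ?_) ?_
  · simp [h1, hp]
  · simp [quad, Fin.sum_univ_three, pow_two]
    abel

end Derivations14
end BraidedRank

namespace BraidedRank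

/-! ### Powers of skew derivations on powers of an element. -/

section SkewPowers

variable {k A : Type*} [Field k] [Ring A] [Algebra k A]

/-- The `t`-analogue `1 + t + ⋯ + t ^ (n - 1)` of `n`. -/
def qNat (t : k) (n : ℕ) : k := ∑ i ∈ Finset.range n, t ^ i

/-- The `t`-analogue of the factorial. -/
def qFactorial (t : k) (n : ℕ) : k := ∏ i ∈ Finset.range n, qNat t (i + 1)

theorem qNat_succ (t : k) (n : ℕ) : qNat t (n + 1) = 1 + t * qNat t n := by
  rw [qNat, Finset.sum_range_succ', qNat, Finset.mul_sum, add_comm]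
  simp [pow_succ']

@[simp] theorem qNat_zero (t : k) : qNat t 0 = 0 := by simp [qNat]

@[simp] theorem qNat_one (t : k) : qNat t 1 = 1 := by simp [qNat]

theorem qFactorial_succ (t : k) (n : ℕ) :
    qFactorial t (n + 1) = qFactorial t n * qNat t (n + 1) := by
  rw [qFactorial, Finset.prod_range_succ, qFactorial]

theorem qFactorial_one_ne_zero [CharZero k] (n : ℕ) : qFactorial (1 : k) n ≠ 0 := by
  refine Finset.prod_ne_zero_iff.2 fun i _ => ?_
  simp only [qNat, one_pow, Finset.sum_const, Finset.card_range, nsmul_eq_mul, mul_one]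
  exact_mod_cast Nat.succ_ne_zero i

theorem qFactorial_ne_zero_of_lt_two (t : k) {n : ℕ} (hn : n < 2) : qFactorial t n ≠ 0 := by
  interval_cases n <;> simp [qFactorial]

theorem pow_apply_pow_mul {D : Module.End k A} {x : A} {c : k}
    (hD : ∀ u, D (x * u) = c • (x * D u)) (N n : ℕ) (u : A) :
    (D ^ N) (x ^ n * u) = c ^ (n * N) • (x ^ n * (D ^ N) u) := by
  have h1 : ∀ n u, D (x ^ n * u) = c ^ n • (x ^ n * D u) := by
    intro n
    induction n with
    | zero => simp
    | succ n ih =>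
      intro u
      rw [pow_succ', mul_assoc, hD, ih, mul_smul_comm, smul_smul, mul_assoc, pow_succ']
  induction N generalizing u with
  | zero => simp
  | succ N ih => rw [pow_succ, Module.End.mul_apply, h1, map_smul, ih, smul_smul,
      Module.End.mul_apply, mul_add, mul_one, pow_add, mul_comm]

theorem skew_pow_succ_mul {D : Module.End k A} {x : A} {c : k}
    (hD : ∀ u, D (x * u) = u + c • (x * D u)) {w : A} (hw : D w = 0) (n : ℕ) :
    D (x ^ (n + 1) * w) = qNat c (n + 1) • (x ^ n * w) := by
  induction n with
  | zero => simp [hD, hw]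
  | succ n ih =>
    rw [pow_succ', mul_assoc, hD, ih, qNat_succ c (n + 1), mul_smul_comm, add_smul, one_smul,
      smul_smul, ← mul_assoc x, ← pow_succ']

/-- The scalar is a product of N consecutive c-numbers; its value matters only when no power of x
remains. -/
theorem pow_skew_pow_add_mul {D : Module.End k A} {x : A} {c : k}
    (hD : ∀ u, D (x * u) = u + c • (x * D u)) {w : A} (hw : D w = 0) (N m : ℕ) :
    ∃ r : k, (D ^ N) (x ^ (m + N) * w) = r • (x ^ m * w) ∧ (m = 0 → r = qFactorial c N) := by
  induction N with
  | zero => exact ⟨1, by simp, by simp [qFactorial]⟩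
  | succ N ih =>
    obtain ⟨r, h, h0⟩ := ih
    refine ⟨qNat c (m + N + 1) * r, ?_, ?_⟩
    · rw [pow_succ, Module.End.mul_apply, ← add_assoc, skew_pow_succ_mul hD hw, map_smul, h,
        smul_smul]
    · rintro rfl
      rw [h0 rfl, qFactorial_succ, zero_add, mul_comm]

theorem pow_skew_pow_mul_of_lt {D : Module.End k A} {x : A} {c : k}
    (hD : ∀ u, D (x * u) = u + c • (x * D u)) {w : A} (hw : D w = 0) {N m : ℕ} (h : m < N) :
    (D ^ N) (x ^ m * w) = 0 := by
  obtain ⟨l, rfl⟩ := Nat.exists_eq_add_of_lt h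
  obtain ⟨r, hr, -⟩ := pow_skew_pow_add_mul hD hw m 0
  rw [show m + l + 1 = l + 1 + m by ring, pow_add, Module.End.mul_apply]
  rw [zero_add] at hr
  rw [hr, map_smul, pow_succ, Module.End.mul_apply]
  simp [hw]

end SkewPowers

/-! ### Polynomial models of the operators that detect powers of x_3. -/

section SkewPolynomial

open Polynomial

variable {k : Type*} [Field k]

/-- The `t`-derivative of polynomials. -/
noncomputable def qDer (t : k) : Module.End k k[X] :=
  (Polynomial.basisMonomials k).constr k fun n => monomial (n - 1) (qNat t n)

theorem qDer_X_pow (t : k) (n : ℕ) : qDer t (X ^ n) = monomial (n - 1) (qNat t n) := by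
  have h := (Polynomial.basisMonomials k).constr_basis k
    (fun n => monomial (n - 1) (qNat t n)) n
  simp only [coe_basisMonomials, ← X_pow_eq_monomial] at h
  exact h

theorem qDer_X_mul (t : k) (f : k[X]) : qDer t (X * f) = f + t • (X * qDer t f) := by
  induction f using Polynomial.induction_on' with
  | add f g hf hg => rw [mul_add, map_add, hf, hg, map_add, mul_add, smul_add]; abel
  | monomial n r =>
    have h1 : monomial n r = r • (X : k[X]) ^ n := by
      rw [X_pow_eq_monomial, smul_monomial, smul_eq_mul, mul_one]
    rw [h1, mul_smul_comm, ← pow_succ', map_smul, map_smul, qDer_X_pow, qDer_X_pow, qNat_succ,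
      mul_smul_comm, smul_comm t, ← smul_add, X_mul_monomial]
    congr 1
    match n with
    | 0 => simp
    | n + 1 =>
      rw [smul_monomial, X_pow_eq_monomial]
      exact map_add (monomial (n + 1)) _ _

/-- The operator `X ^ n ↦ -p ⌊n / 2⌋ X ^ (n - 2)` on polynomials. -/
noncomputable def halfDer (p : k) : Module.End k k[X] :=
  (Polynomial.basisMonomials k).constr k fun n => monomial (n - 2) (-p * (n / 2 : ℕ))

/-- The truncated n - 2 is harmless: the coefficient vanishes for n < 2. -/
theorem halfDer_X_pow (p : k) (n : ℕ) :
    halfDer p (X ^ n) = monomial (n - 2) (-p * (n / 2 : ℕ)) := by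
  have h := (Polynomial.basisMonomials k).constr_basis k
    (fun n => monomial (n - 2) (-p * (n / 2 : ℕ))) n
  simp only [coe_basisMonomials, ← X_pow_eq_monomial] at h
  exact h

theorem qNat_neg_one (n : ℕ) : qNat (-1 : k) n = (n % 2 : ℕ) := by
  induction n with
  | zero => simp
  | succ n ih =>
    rw [qNat_succ, ih]
    rcases Nat.mod_two_eq_zero_or_one n with h | h
    · rw [h, show (n + 1) % 2 = 1 by omega]; simp
    · rw [h, show (n + 1) % 2 = 0 by omega]; simp

/-- This is ⌊(n + 1)/2⌋ = ⌊n/2⌋ + (n mod 2), together with the fact that n mod 2 is the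
(-1)-analogue of n. The operator ∂_2∂_1 obeys the same recursion modulo x_1. -/
theorem halfDer_X_mul (p : k) (f : k[X]) :
    halfDer p (X * f) = X * halfDer p f - p • qDer (-1) f := by
  induction f using Polynomial.induction_on' with
  | add f g hf hg => rw [mul_add, map_add, hf, hg, map_add, map_add, mul_add, smul_add]; abel
  | monomial n r =>
    have h1 : monomial n r = r • (X : k[X]) ^ n := by
      rw [X_pow_eq_monomial, smul_monomial, smul_eq_mul, mul_one]
    rw [h1, mul_smul_comm, ← pow_succ', map_smul, map_smul, map_smul, halfDer_X_pow,
      halfDer_X_pow, qDer_X_pow, qNat_neg_one, mul_smul_comm, smul_comm p, ← smul_sub,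
      X_mul_monomial]
    congr 1
    match n with
    | 0 => simp
    | 1 => simp [← C_mul']
    | n + 2 =>
      rw [smul_monomial, show (n + 2 + 1) / 2 = (n + 2) / 2 + (n + 2) % 2 by omega]
      refine Eq.trans ?_ (map_sub (monomial (n + 1)) _ _)
      congr 1
      push_cast
      rw [smul_eq_mul]
      ring

theorem halfDer_pow_X_pow (p : k) (N m : ℕ) : 
    ∃ r : k, (halfDer p ^ N) (X ^ (m + 2 * N)) = r • (X : k[X]) ^ m ∧
      (m < 2 → r = (-p) ^ N * N.factorial) := by
  induction N with
  | zero => exact ⟨1, by simp, by simp⟩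
  | succ N ih =>
    obtain ⟨r, h, h0⟩ := ih
    refine ⟨-p * ((m + 2 * N + 2) / 2 : ℕ) * r, ?_, ?_⟩
    · rw [pow_succ, Module.End.mul_apply, halfDer_X_pow, mul_smul, ← h, ← map_smul, 
        X_pow_eq_monomial, smul_monomial]
      simp [mul_add, ← add_assoc]
    · intro hm
      rw [h0 hm, show (m + 2 * N + 2) / 2 = N + 1 by omega, Nat.factorial_succ]
      push_cast
      ring

theorem halfDer_pow_X_pow_of_lt (p : k) {N m : ℕ} (h : m < 2 * N) :
    (halfDer p ^ N) (X ^ m) = 0 := by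
  induction N generalizing m with
  | zero => omega
  | succ N ih =>
    rw [pow_succ, Module.End.mul_apply, halfDer_X_pow, ← mul_one (-p * _), ← smul_eq_mul,
      ← smul_monomial, ← X_pow_eq_monomial, map_smul]
    by_cases hm : m < 2
    · simp [Nat.div_eq_of_lt hm]
    · rw [ih (by omega), smul_zero]

end SkewPolynomial
end BraidedRank

namespace BraidedRank

/-! ### Independence of ordered monomials modulo the Nichols ideal. -/

section Functionals

open Polynomial

variable {k : Type*} [Field k] {t a b p : k} {ht : t ≠ 0}

/-- The algebra map from the tensor algebra to polynomials that sends `x_3` to `X` and the other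
generators to zero. -/
noncomputable def toPoly (k : Type*) [Field k] : T k (Fin 3) →ₐ[k] k[X] :=
  FreeAlgebra.lift k fun i => if i = 2 then X else 0

theorem toPoly_gen (i : Fin 3) : toPoly k (gen k i) = if i = 2 then X else 0 := by
  simp [toPoly]

theorem counit_eq_coeff_toPoly (u : T k (Fin 3)) :
    counit k (Fin 3) u = (toPoly k u).coeff 0 := by
  have : counit k (Fin 3) = (Polynomial.aeval (0 : k)).comp (toPoly k) := by
    ext i
    simp only [Function.comp_apply, counit_ι, AlgHom.comp_apply, toPoly_gen]
    split_ifs <;> simp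
  rw [this, AlgHom.comp_apply, Polynomial.coeff_zero_eq_aeval_zero]

/-- The terms that distinguish ∂_3 from the t-derivative have x_1 or x_2 as left factor, and
`toPoly` kills them. -/
theorem toPoly_der_two (u : T k (Fin 3)) :
    toPoly k (der (braiding14 t a b p ht) 2 u) = qDer t (toPoly k u) := by
  induction u using T_induction with
  | one =>
    have := qDer_X_pow t 0
    rw [pow_zero] at this
    simp [der_one, this]
  | mul i u hu =>
    fin_cases i
    · have := der14_two_gen_zero (t := t) (a := a) (b := b) (p := p) (ht := ht) u
      simp [this, toPoly_gen]
    · have := der14_two_gen_one (t := t) (a := a) (b := b) (p := p) (ht := ht) u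
      simp [this, toPoly_gen]
    · have := der14_two_gen_two (t := t) (a := a) (b := b) (p := p) (ht := ht) u
      simp [this, toPoly_gen, qDer_X_mul, hu]
  | add u v hu hv => simp only [map_add, hu, hv]
  | smul r u hu => simp only [map_smul, hu]

theorem toPoly_der_two_pow (N : ℕ) (u : T k (Fin 3)) :
    toPoly k ((der (braiding14 t a b p ht) 2 ^ N) u) = (qDer t ^ N) (toPoly k u) := by
  induction N generalizing u with
  | zero => simp
  | succ N ih => rw [pow_succ, Module.End.mul_apply, ih, toPoly_der_two, pow_succ,
      Module.End.mul_apply]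

/-- The span of the words in `x_1` and `x_3`. -/
inductive InOneThree : T k (Fin 3) → Prop
  | one : InOneThree 1
  | gen_zero_mul {u} : InOneThree u → InOneThree (gen k 0 * u)
  | gen_two_mul {u} : InOneThree u → InOneThree (gen k 2 * u)
  | add {u v} : InOneThree u → InOneThree v → InOneThree (u + v)
  | smul (r : k) {u} : InOneThree u → InOneThree (r • u)

namespace InOneThree

theorem zero : InOneThree (0 : T k (Fin 3)) := by simpa using smul (0 : k) one

theorem sub {u v : T k (Fin 3)} (hu : InOneThree u) (hv : InOneThree v) :
    InOneThree (u - v) := by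
  simpa [sub_eq_add_neg] using hu.add (hv.smul (-1))

theorem gen_zero_pow_mul (n : ℕ) {u : T k (Fin 3)} (hu : InOneThree u) :
    InOneThree (gen k 0 ^ n * u) := by
  induction n with
  | zero => simpa
  | succ n ih => rw [pow_succ', mul_assoc]; exact ih.gen_zero_mul

theorem gen_two_pow (n : ℕ) : InOneThree (gen k 2 ^ n) := by
  induction n with
  | zero => simpa using one
  | succ n ih => rw [pow_succ']; exact ih.gen_two_mul

theorem der_one_eq_zero {u : T k (Fin 3)} (hu : InOneThree u) :
    der (braiding14 t a b p ht) 1 u = 0 := by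
  induction hu with
  | one => exact der_one _ _
  | gen_zero_mul _ ih => simp [der14_one_gen_zero, ih]
  | gen_two_mul _ ih => simp [der14_one_gen_two, ih]
  | add _ _ h h' => simp [h, h']
  | smul r _ h => simp [h]

theorem der_two {u : T k (Fin 3)} (hu : InOneThree u) :
    InOneThree (der (braiding14 t a b p ht) 2 u) := by
  induction hu with
  | one => rw [der_one]; exact zero
  | gen_zero_mul _ ih => rw [der14_two_gen_zero]; exact ih.gen_zero_mul.smul _
  | gen_two_mul h ih =>
    rw [der14_two_gen_two]
    exact (h.add (ih.gen_two_mul.smul _)).add (ih.gen_zero_mul.smul _)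
  | add _ _ h h' => rw [map_add]; exact h.add h'
  | smul r _ h => rw [map_smul]; exact h.smul r

variable (a b p ht) in
/-- The composition `∂_2 ∂_1` of skew derivations. -/
noncomputable def der₂₁ : Module.End k (T k (Fin 3)) :=
  der (braiding14 t a b p ht) 1 * der (braiding14 t a b p ht) 0

theorem der₂₁_def (u : T k (Fin 3)) : der₂₁ a b p ht u =
    der (braiding14 t a b p ht) 1 (der (braiding14 t a b p ht) 0 u) := rfl

theorem der₂₁_gen_zero_mul (h1 : t = -1) {u : T k (Fin 3)} (hu : InOneThree u) :
    der₂₁ a b p ht (gen k 0 * u) = gen k 0 * der₂₁ a b p ht u := by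
  rw [der₂₁_def, der14_zero_gen_zero, map_sub, map_add, hu.der_one_eq_zero, map_smul,
    map_smul, der14_one_gen_zero, der14_one_gen_zero, hu.der_two.der_one_eq_zero]
  simp [h1, der₂₁_def]

/-- The term with p comes from x_1 ⊗ x_2 in c(x_3 ⊗ x_3): it puts x_2 ∂_3(u) into ∂_1(x_3 u), and
∂_2 removes this x_2. All other contributions of ∂_3(u) contain no x_2 and die under ∂_2. -/
theorem der₂₁_gen_two_mul (h1 : t = -1) {u : T k (Fin 3)} (hu : InOneThree u) :
    der₂₁ a b p ht (gen k 2 * u) = gen k 2 * der₂₁ a b p ht u +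
      (2 * b) • (gen k 0 * der₂₁ a b p ht u) - p • der (braiding14 t a b p ht) 2 u := by
  rw [der₂₁_def, der14_zero_gen_two]
  simp only [map_sub, map_add, map_smul, der14_one_gen_two, der14_one_gen_zero,
    der14_one_gen_one, hu.der_two.der_one_eq_zero, der₂₁_def]
  simp [h1, smul_smul]
  module

theorem der₂₁_apply (h1 : t = -1) {u : T k (Fin 3)} (hu : InOneThree u) :
    InOneThree (der₂₁ a b p ht u) := by
  induction hu with
  | one => rw [der₂₁_def, der_one, map_zero]; exact zero
  | gen_zero_mul hu ih => rw [der₂₁_gen_zero_mul h1 hu]; exact ih.gen_zero_mul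
  | gen_two_mul hu ih =>
    rw [der₂₁_gen_two_mul h1 hu]
    exact (ih.gen_two_mul.add (ih.gen_zero_mul.smul _)).sub (hu.der_two.smul _)
  | add _ _ h h' => rw [map_add]; exact h.add h'
  | smul r _ h => rw [map_smul]; exact h.smul r

theorem toPoly_der₂₁ (h1 : t = -1) {u : T k (Fin 3)} (hu : InOneThree u) :
    toPoly k (der₂₁ a b p ht u) = halfDer p (toPoly k u) := by
  induction hu with
  | one =>
    have := halfDer_X_pow p 0
    rw [pow_zero] at this
    simp [der₂₁_def, der_one, this]
  | gen_zero_mul hu ih => rw [der₂₁_gen_zero_mul h1 hu]; simp [toPoly_gen]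
  | gen_two_mul hu ih =>
    rw [der₂₁_gen_two_mul h1 hu, map_sub, map_add, map_mul, map_smul, map_smul, map_mul, map_mul,
      toPoly_der_two, ih, toPoly_gen, toPoly_gen, h1, if_pos rfl,
      halfDer_X_mul]
    simp
  | add _ _ h h' => rw [map_add, map_add, h, h', map_add, map_add]
  | smul r _ h => rw [map_smul, map_smul, h, map_smul, map_smul]

theorem toPoly_der₂₁_pow (h1 : t = -1) (N : ℕ) {u : T k (Fin 3)} (hu : InOneThree u) :
    toPoly k ((der₂₁ a b p ht ^ N) u) = (halfDer p ^ N) (toPoly k u) := by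
  induction N generalizing u with
  | zero => simp
  | succ N ih => rw [pow_succ, Module.End.mul_apply, ih (der₂₁_apply h1 hu), toPoly_der₂₁ h1 hu,
      pow_succ, Module.End.mul_apply]

theorem der₂₁_pow_gen_zero_pow_mul (h1 : t = -1) (N n : ℕ) {u : T k (Fin 3)}
    (hu : InOneThree u) :
    (der₂₁ a b p ht ^ N) (gen k 0 ^ n * u) = gen k 0 ^ n * (der₂₁ a b p ht ^ N) u := by
  have h : ∀ n, ∀ u, InOneThree u →
      der₂₁ a b p ht (gen k 0 ^ n * u) = gen k 0 ^ n * der₂₁ a b p ht u := by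
    intro n u hu
    induction n with
    | zero => simp
    | succ n ih =>
      rw [pow_succ', mul_assoc, der₂₁_gen_zero_mul h1 (hu.gen_zero_pow_mul n), ih, mul_assoc]
  induction N generalizing u with
  | zero => simp
  | succ N ih =>
    rw [pow_succ, Module.End.mul_apply, h n u hu, ih (der₂₁_apply h1 hu), Module.End.mul_apply]

end InOneThree

/-- The ordered monomials in the generators of the tensor algebra. -/
noncomputable def mono (k : Type*) [Field k] (e : Fin 3 → ℕ) : T k (Fin 3) :=
  gen k 0 ^ e 0 * gen k 1 ^ e 1 * gen k 2 ^ e 2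

theorem der_one_pow_mono_of_lt {e : Fin 3 → ℕ} {N : ℕ} (h : e 1 < N) :
    (der (braiding14 t a b p ht) 1 ^ N) (mono k e) = 0 := by
  rw [mono, mul_assoc, pow_apply_pow_mul der14_one_gen_zero,
    pow_skew_pow_mul_of_lt der14_one_gen_one (InOneThree.gen_two_pow _).der_one_eq_zero h,
    mul_zero, smul_zero]

theorem der_one_pow_mono (e : Fin 3 → ℕ) :
    (der (braiding14 t a b p ht) 1 ^ e 1) (mono k e) =
      (t ^ (e 0 * e 1) * qFactorial t (e 1)) • (gen k 0 ^ e 0 * gen k 2 ^ e 2) := by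
  obtain ⟨r, hr, h0⟩ := pow_skew_pow_add_mul (der14_one_gen_one (ht := ht) (a := a) (b := b)
    (p := p)) (InOneThree.gen_two_pow (e 2)).der_one_eq_zero (e 1) 0
  rw [zero_add, pow_zero, one_mul, h0 rfl] at hr
  rw [mono, mul_assoc, pow_apply_pow_mul der14_one_gen_zero, hr, mul_smul_comm, smul_smul]

/-- No assumption is made on w, so ∂_1 and ∂_3 of w do appear, but always behind at least as many
x_1 as before. The counit removes such errors in the end. -/
theorem der_zero_gen_zero_pow_succ_mul (m : ℕ) (w : T k (Fin 3)) :
    ∃ z, der (braiding14 t a b p ht) 0 (gen k 0 ^ (m + 1) * w) =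
      qNat t (m + 1) • (gen k 0 ^ m * w) + gen k 0 ^ (m + 1) * z := by
  induction m with
  | zero =>
    refine ⟨t • der (braiding14 t a b p ht) 0 w - (t * a) • der (braiding14 t a b p ht) 2 w, ?_⟩
    simp [der14_zero_gen_zero, mul_sub, add_sub_assoc]
  | succ m ih =>
    obtain ⟨z, hz⟩ := ih
    have h2 : der (braiding14 t a b p ht) 2 (gen k 0 ^ (m + 1) * w) =
        t ^ (m + 1) • (gen k 0 ^ (m + 1) * der (braiding14 t a b p ht) 2 w) := by
      simpa using pow_apply_pow_mul (der14_two_gen_zero (ht := ht) (a := a) (b := b) (p := p)) 1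
        (m + 1) w
    refine ⟨t • z - (t * a * t ^ (m + 1)) • der (braiding14 t a b p ht) 2 w, ?_⟩
    rw [pow_succ', mul_assoc, der14_zero_gen_zero, hz, h2, qNat_succ t (m + 1)]
    simp only [mul_add, mul_sub, mul_smul_comm, add_smul, one_smul, smul_add, smul_smul,
      ← mul_assoc, ← pow_succ']
    abel

theorem der_zero_pow_gen_zero_pow_mul (N m : ℕ) (w : T k (Fin 3)) :
    ∃ (r : k) (z : T k (Fin 3)), (der (braiding14 t a b p ht) 0 ^ N) (gen k 0 ^ (m + N) * w) =
      r • (gen k 0 ^ m * w) + gen k 0 ^ (m + 1) * z ∧ (m = 0 → r = qFactorial t N) := by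
  induction N generalizing m w with
  | zero => exact ⟨1, 0, by simp, by simp [qFactorial]⟩
  | succ N ih =>
    obtain ⟨z, hz⟩ := der_zero_gen_zero_pow_succ_mul (ht := ht) (a := a) (b := b) (p := p)
      (m + N) w
    obtain ⟨r, z₁, h₁, hr⟩ := ih m w
    -- The error term has one more x_1, so the induction hypothesis is applied to it with m + 1;
    -- this is why m and w vary.
    obtain ⟨r', z₂, h₂, -⟩ := ih (m + 1) z
    refine ⟨qNat t (m + N + 1) * r, qNat t (m + N + 1) • z₁ + r' • z + gen k 0 * z₂, ?_, ?_⟩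
    · rw [pow_succ, Module.End.mul_apply, ← add_assoc, hz, map_add, map_smul, h₁,
        show m + N + 1 = m + 1 + N by ring, h₂]
      simp only [mul_add, smul_add, mul_smul_comm, smul_smul, ← mul_assoc, ← pow_succ]
      abel
    · rintro rfl
      rw [hr rfl, qFactorial_succ, zero_add, mul_comm]

theorem counit_der_zero_pow_of_lt {N m : ℕ} (h : N < m) (w : T k (Fin 3)) :
    counit k (Fin 3) ((der (braiding14 t a b p ht) 0 ^ N) (gen k 0 ^ m * w)) = 0 := by
  obtain ⟨l, rfl⟩ := Nat.exists_eq_add_of_lt h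
  obtain ⟨r, z, hz, -⟩ := der_zero_pow_gen_zero_pow_mul (ht := ht) (a := a) (b := b) (p := p)
    N (l + 1) w
  rw [show N + l + 1 = l + 1 + N by ring, hz]
  simp

theorem counit_der_zero_pow (N : ℕ) (w : T k (Fin 3)) :
    counit k (Fin 3) ((der (braiding14 t a b p ht) 0 ^ N) (gen k 0 ^ N * w)) =
      qFactorial t N * counit k (Fin 3) w := by
  obtain ⟨r, z, hz, hr⟩ := der_zero_pow_gen_zero_pow_mul (ht := ht) (a := a) (b := b) (p := p)
    N 0 w
  rw [zero_add] at hz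
  rw [hz, hr rfl]
  simp

theorem pow_mem {B : Braiding k (Fin 3)} {D : Module.End k (T k (Fin 3))}
    (hD : ∀ u ∈ nicholsIdeal B, D u ∈ nicholsIdeal B) (N : ℕ) :
    ∀ u ∈ nicholsIdeal B, (D ^ N) u ∈ nicholsIdeal B := by
  induction N with
  | zero => simp
  | succ N ih => exact fun u hu => by rw [pow_succ, Module.End.mul_apply]; exact ih _ (hD u hu)

/-- Ordered monomials are linearly independent modulo the ideal of the Nichols algebra as soon as
there are operators `Ψ N` that preserve this ideal and separate the powers of `x_3`. -/
theorem coeff_eq_zero_of_sum_mem {S : Set (Fin 3 → ℕ)}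
    (h0 : ∀ e ∈ S, qFactorial t (e 0) ≠ 0) (h1 : ∀ e ∈ S, qFactorial t (e 1) ≠ 0)
    (Ψ : ℕ → Module.End k (T k (Fin 3)))
    (hΨ : ∀ N, ∀ u ∈ nicholsIdeal (braiding14 t a b p ht),
      Ψ N u ∈ nicholsIdeal (braiding14 t a b p ht))
    (hmul : ∀ N n m, ∃ s : k, s ≠ 0 ∧
      Ψ N (gen k 0 ^ n * gen k 2 ^ m) = s • (gen k 0 ^ n * Ψ N (gen k 2 ^ m)))
    (hne : ∀ N m, m ≠ N → counit k (Fin 3) (Ψ N (gen k 2 ^ m)) = 0)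
    (heq : ∀ e ∈ S, counit k (Fin 3) (Ψ (e 2) (gen k 2 ^ e 2)) ≠ 0)
    (s : Finset (Fin 3 → ℕ)) (hs : (s : Set (Fin 3 → ℕ)) ⊆ S) (g : (Fin 3 → ℕ) → k)
    (hg : ∑ e ∈ s, g e • mono k e ∈ nicholsIdeal (braiding14 t a b p ht)) :
    ∀ e ∈ s, g e = 0 := by
  by_contra! hcon
  set V := braiding14 t a b p ht with hV
  -- The functional dual to the monomial e: strip x_2, then detect x_3, then strip x_1, then take
  -- the constant term.
  let φ : (Fin 3 → ℕ) → T k (Fin 3) →ₗ[k] k := fun e => (counit k (Fin 3)).toLinearMap ∘ₗ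
    (der V 0 ^ e 0 : Module.End k (T k (Fin 3))) ∘ₗ Ψ (e 2) ∘ₗ
    (der V 1 ^ e 1 : Module.End k (T k (Fin 3)))
  have hφJ : ∀ e, ∀ u ∈ nicholsIdeal V, φ e u = 0 := fun e u hu =>
    counit_eq_zero (pow_mem (fun u => der_mem 0) _ _ (hΨ _ _ (pow_mem (fun u => der_mem 1) _ _ hu)))
  have hφ1 : ∀ e e' : Fin 3 → ℕ, e' 1 < e 1 → φ e (mono k e') = 0 := by
    intro e e' h
    simp [φ, hV, der_one_pow_mono_of_lt h]
  have hφ : ∀ e e' : Fin 3 → ℕ, e' 1 = e 1 → ∃ s : k, s ≠ 0 ∧ φ e (mono k e') =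
      s * qFactorial t (e 1) * counit k (Fin 3) ((der V 0 ^ e 0 : Module.End k (T k (Fin 3)))
        (gen k 0 ^ e' 0 * Ψ (e 2) (gen k 2 ^ e' 2))) := by
    intro e e' h
    obtain ⟨s, hs0, hs⟩ := hmul (e 2) (e' 0) (e' 2)
    refine ⟨t ^ (e' 0 * e 1) * s, mul_ne_zero (pow_ne_zero _ ht) hs0, ?_⟩
    have := der_one_pow_mono (ht := ht) (a := a) (b := b) (p := p) e'
    rw [h] at this
    simp only [φ, LinearMap.comp_apply, hV, this, map_smul, hs, AlgHom.toLinearMap_apply,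
      smul_eq_mul]
    ring
  obtain ⟨e₀, he₀, hge₀⟩ := hcon
  classical
  -- The exponent of x_2 is taken maximal and then that of x_1 minimal: monomials with fewer x_2 die
  -- under the power of ∂_2, and those with more x_1 keep a factor x_1, which the counit kills. For
  -- the remaining ones the exponent of x_3 differs.
  obtain ⟨e, he, hmax⟩ := (s.filter fun e => g e ≠ 0).exists_max_image
    (fun e => toLex (e 1, OrderDual.toDual (e 0))) ⟨e₀, by simp [he₀, hge₀]⟩
  obtain ⟨hes, hge⟩ := Finset.mem_filter.1 he
  have hsum := hφJ e _ hg
  rw [map_sum, Finset.sum_eq_single e] at hsum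
  · obtain ⟨s, hs0, hs1⟩ := hφ e e rfl
    rw [map_smul, hs1, counit_der_zero_pow, smul_eq_mul] at hsum
    exact mul_ne_zero hge (mul_ne_zero (mul_ne_zero hs0 (h1 e (hs hes)))
      (mul_ne_zero (h0 e (hs hes)) (heq e (hs hes)))) hsum
  · intro e' he's hne'
    rw [map_smul]
    by_cases hge' : g e' = 0
    · rw [hge', zero_smul]
    suffices φ e (mono k e') = 0 by rw [this, smul_zero]
    have hle := hmax e' (Finset.mem_filter.2 ⟨he's, hge'⟩)
    rw [Prod.Lex.toLex_le_toLex] at hle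
    rcases hle with hlt | ⟨h11, h00⟩
    · exact hφ1 e e' hlt
    · obtain ⟨s, hs0, hs1⟩ := hφ e e' h11
      rw [hs1]
      rcases (show e 0 ≤ e' 0 from h00).lt_or_eq with h | h
      · rw [counit_der_zero_pow_of_lt h, mul_zero]
      · have h22 : e' 2 ≠ e 2 := fun h22 => hne' (funext fun i => by fin_cases i <;> simp_all)
        rw [← h, counit_der_zero_pow, hne _ _ h22, mul_zero, mul_zero]
  · exact fun h => absurd hes h

theorem counit_der_two_pow (N m : ℕ) :
    counit k (Fin 3) ((der (braiding14 t a b p ht) 2 ^ N) (gen k 2 ^ m)) =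
      if m = N then qFactorial t N else 0 := by
  rw [counit_eq_coeff_toPoly, toPoly_der_two_pow, map_pow, toPoly_gen, if_pos rfl]
  have h1 : qDer t (1 : k[X]) = 0 := by
    have := qDer_X_pow t 0
    simpa using this
  rcases lt_or_ge m N with h | h
  · have := pow_skew_pow_mul_of_lt (qDer_X_mul t) h1 h
    rw [mul_one] at this
    rw [this, if_neg h.ne, coeff_zero]
  · obtain ⟨l, rfl⟩ := Nat.exists_eq_add_of_le' h
    obtain ⟨r, hr, h0⟩ := pow_skew_pow_add_mul (qDer_X_mul t) h1 N l
    rw [mul_one, mul_one] at hr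
    rw [hr]
    rcases Nat.eq_zero_or_pos l with rfl | hl
    · simp [h0 rfl]
    · simp [hl.ne, hl.ne']

theorem coeff_eq_zero_of_sum_mem_of_qFactorial {S : Set (Fin 3 → ℕ)}
    (h : ∀ e ∈ S, ∀ i, qFactorial t (e i) ≠ 0)
    (s : Finset (Fin 3 → ℕ)) (hs : (s : Set (Fin 3 → ℕ)) ⊆ S) (g : (Fin 3 → ℕ) → k)
    (hg : ∑ e ∈ s, g e • mono k e ∈ nicholsIdeal (braiding14 t a b p ht)) :
    ∀ e ∈ s, g e = 0 := by
  refine coeff_eq_zero_of_sum_mem (fun e he => h e he 0) (fun e he => h e he 1)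
    (fun N => der (braiding14 t a b p ht) 2 ^ N) (fun N => pow_mem (fun u => der_mem 2) N)
    (fun N n m => ⟨t ^ (n * N), pow_ne_zero _ ht, pow_apply_pow_mul der14_two_gen_zero N n _⟩)
    (fun N m hm => ?_) (fun e he => ?_) s hs g hg
  · rw [counit_der_two_pow, if_neg hm]
  · rw [counit_der_two_pow, if_pos rfl]
    exact h e he 2

theorem coeff_eq_zero_of_sum_mem_of_ne_zero [CharZero k] (h1 : t = -1) (hp : p ≠ 0)
    (s : Finset (Fin 3 → ℕ)) (hs : (s : Set (Fin 3 → ℕ)) ⊆ B₁) (g : (Fin 3 → ℕ) → k)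
    (hg : ∑ e ∈ s, g e • mono k e ∈ nicholsIdeal (braiding14 t a b p ht)) :
    ∀ e ∈ s, g e = 0 := by
  -- Each ∂_2∂_1 lowers the power of x_3 by two, and one ∂_3 removes the last x_3 when N is odd. The
  -- scalars -p, -2p, … multiply to (-p)^⌊N/2⌋ ⌊N/2⌋!, nonzero in characteristic zero for p ≠ 0.
  have key : ∀ N m, counit k (Fin 3) ((der (braiding14 t a b p ht) 2 ^ (N % 2))
      ((InOneThree.der₂₁ a b p ht ^ (N / 2)) (gen k 2 ^ m))) =
      if m = N then (-p) ^ (N / 2) * (N / 2).factorial else 0 := by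
    intro N m
    rw [counit_eq_coeff_toPoly, toPoly_der_two_pow,
      InOneThree.toPoly_der₂₁_pow h1 _ (InOneThree.gen_two_pow m), map_pow, toPoly_gen,
      if_pos rfl]
    rcases lt_or_ge m (2 * (N / 2)) with h | h
    · rw [halfDer_pow_X_pow_of_lt p h, if_neg (by omega)]
      simp
    · obtain ⟨l, rfl⟩ := Nat.exists_eq_add_of_le' h
      obtain ⟨r, hr, h0⟩ := halfDer_pow_X_pow p (N / 2) l
      rw [hr, map_smul]
      rcases Nat.mod_two_eq_zero_or_one N with h2 | h2
      · rw [h2, pow_zero, Module.End.one_apply, coeff_smul, coeff_X_pow, smul_eq_mul]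
        by_cases hl : l = 0
        · rw [if_pos hl.symm, if_pos (by omega), h0 (by omega), mul_one]
        · rw [if_neg (Ne.symm hl), if_neg (by omega), mul_zero]
      · rw [h2, pow_one, qDer_X_pow, show qNat t l = (l % 2 : ℕ) from h1 ▸ qNat_neg_one l, coeff_smul,
          coeff_monomial, smul_eq_mul]
        by_cases hl : l = 1
        · subst hl
          rw [if_pos (by omega), if_pos (by omega), h0 (by omega)]
          simp
        · rw [if_neg (show ¬ l + 2 * (N / 2) = N by omega)]
          by_cases hl0 : l = 0
          · simp [hl0]
          · rw [if_neg (by omega), mul_zero]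
  refine coeff_eq_zero_of_sum_mem (fun e he => qFactorial_ne_zero_of_lt_two t he.1)
    (fun e he => qFactorial_ne_zero_of_lt_two t he.2)
    (fun N => der (braiding14 t a b p ht) 2 ^ (N % 2) * InOneThree.der₂₁ a b p ht ^ (N / 2))
    (fun N u hu => pow_mem (fun u => der_mem 2) _ _
      (pow_mem (D := InOneThree.der₂₁ a b p ht)
        (fun u hu => der_mem (u := der _ 0 u) 1 (der_mem 0 hu)) _ _ hu))
    (fun N n m => ⟨t ^ (n * (N % 2)), pow_ne_zero _ ht, ?_⟩)
    (fun N m hm => ?_) (fun e he => ?_) s hs g hg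
  · rw [Module.End.mul_apply, InOneThree.der₂₁_pow_gen_zero_pow_mul h1 _ _
      (InOneThree.gen_two_pow m), pow_apply_pow_mul der14_two_gen_zero, Module.End.mul_apply]
  · rw [Module.End.mul_apply, key, if_neg hm]
  · rw [Module.End.mul_apply, key, if_pos rfl]
    exact mul_ne_zero (pow_ne_zero _ (neg_ne_zero.2 hp)) (Nat.cast_ne_zero.2 (Nat.factorial_ne_zero _))

end Functionals
end BraidedRank

namespace BraidedRank

/-! ### Straightening into ordered monomials. -/

section OrderedMonomials

variable {k A : Type*} [Field k] [Ring A] [Algebra k A]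

/-- The ordered monomials in three elements of an algebra. -/
def orderedMonomial (x : Fin 3 → A) (e : Fin 3 → ℕ) : A := x 0 ^ e 0 * x 1 ^ e 1 * x 2 ^ e 2

/-- The span of the ordered monomials of degree at most `n` with exponents in `S`. -/
def monomialFiltration (k : Type*) [Field k] [Algebra k A] (x : Fin 3 → A)
    (S : Set (Fin 3 → ℕ)) (n : ℕ) : Submodule k A :=
  Submodule.span k (orderedMonomial x '' {e | e ∈ S ∧ e 0 + e 1 + e 2 ≤ n})

theorem pow_mul_pow_mul_pow_mem {x : Fin 3 → A} {S : Set (Fin 3 → ℕ)} {n i j l : ℕ}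
    (hS : ![i, j, l] ∈ S) (hn : i + j + l ≤ n) :
    x 0 ^ i * x 1 ^ j * x 2 ^ l ∈ monomialFiltration k x S n :=
  Submodule.subset_span ⟨![i, j, l], ⟨hS, by simpa using hn⟩, by simp [orderedMonomial]⟩

theorem monomialFiltration_mono (x : Fin 3 → A) (S : Set (Fin 3 → ℕ)) :
    Monotone (monomialFiltration k x S) := fun _ _ h =>
  Submodule.span_mono (Set.image_mono fun _ he => ⟨he.1, he.2.trans h⟩)

/-- Left multiplication with the `x_i` raises the degree of ordered monomials by at most one. -/
def IsStraightening (k : Type*) [Field k] [Algebra k A] (x : Fin 3 → A)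
    (S : Set (Fin 3 → ℕ)) : Prop :=
  ∀ q, ∀ e ∈ S, x q * orderedMonomial x e ∈ monomialFiltration k x S (e 0 + e 1 + e 2 + 1)

theorem IsStraightening.mul_mem {x : Fin 3 → A} {S : Set (Fin 3 → ℕ)}
    (h : IsStraightening k x S) (q : Fin 3) {n : ℕ} {u : A}
    (hu : u ∈ monomialFiltration k x S n) : x q * u ∈ monomialFiltration k x S (n + 1) := by
  refine (Submodule.span_le
    (p := (monomialFiltration k x S (n + 1)).comap (LinearMap.mulLeft k (x q)))).2 ?_ hu
  rintro _ ⟨e, he, rfl⟩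
  exact monomialFiltration_mono x S (Nat.succ_le_succ he.2) (h q e he.1)

/-- The commutator with x_3 is a derivation of the commuting x_1 and x_2 with x_1 ↦ a x_1^2 and x_2
↦ -d x_1 x_2. It therefore multiplies x_1^i x_2^j by (i a - j d) x_1. -/
theorem isStraightening_sym {x : Fin 3 → A} {a d : k} (h10 : x 1 * x 0 = x 0 * x 1)
    (h20 : x 2 * x 0 = x 0 * x 2 + a • x 0 ^ 2)
    (h21 : x 2 * x 1 = x 1 * x 2 - d • (x 0 * x 1)) : IsStraightening k x Set.univ := by
  have c10 : ∀ i, x 1 * x 0 ^ i = x 0 ^ i * x 1 := fun i => Commute.pow_right h10 i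
  have c01 : ∀ j, x 1 ^ j * x 0 = x 0 * x 1 ^ j := fun j => Commute.pow_left h10 j
  have c20 : ∀ i : ℕ, x 2 * x 0 ^ i = x 0 ^ i * x 2 + (i * a) • x 0 ^ (i + 1) := by
    intro i
    induction i with
    | zero => simp
    | succ i ih =>
      rw [pow_succ, ← mul_assoc, ih, add_mul, mul_assoc, h20, mul_add, mul_smul_comm,
        smul_mul_assoc, ← pow_add, ← mul_assoc, ← pow_succ, ← pow_succ]
      push_cast
      module
  have c21 : ∀ j : ℕ, x 2 * x 1 ^ j = x 1 ^ j * x 2 - (j * d) • (x 0 * x 1 ^ j) := by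
    intro j
    induction j with
    | zero => simp
    | succ j ih =>
      rw [pow_succ, ← mul_assoc, ih, sub_mul, mul_assoc, h21, mul_sub, mul_smul_comm,
        smul_mul_assoc, ← mul_assoc, ← mul_assoc, c01, mul_assoc, mul_assoc]
      push_cast
      module
  intro q e _
  rw [orderedMonomial]
  generalize e 0 = i, e 1 = j, e 2 = l
  fin_cases q
  · have : x 0 * (x 0 ^ i * x 1 ^ j * x 2 ^ l) = x 0 ^ (i + 1) * x 1 ^ j * x 2 ^ l := by
      simp only [pow_succ', mul_assoc]
    exact this ▸ pow_mul_pow_mul_pow_mem trivial (by omega)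
  · have : x 1 * (x 0 ^ i * x 1 ^ j * x 2 ^ l) = x 0 ^ i * x 1 ^ (j + 1) * x 2 ^ l := by
      rw [← mul_assoc, ← mul_assoc, c10, pow_succ']
      simp only [mul_assoc]
    exact this ▸ pow_mul_pow_mul_pow_mem trivial (by omega)
  · have : x 2 * (x 0 ^ i * x 1 ^ j * x 2 ^ l) = x 0 ^ i * x 1 ^ j * x 2 ^ (l + 1) +
        (i * a - j * d) • (x 0 ^ (i + 1) * x 1 ^ j * x 2 ^ l) := by
      rw [← mul_assoc, ← mul_assoc, c20, add_mul, mul_assoc _ (x 2), c21, pow_succ' (x 2),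
        pow_succ (x 0)]
      simp only [mul_sub, sub_mul, add_mul, mul_assoc, mul_smul_comm, smul_mul_assoc]
      module
    exact this ▸ add_mem (pow_mul_pow_mul_pow_mem trivial (by omega))
      (Submodule.smul_mem _ _ (pow_mul_pow_mul_pow_mem trivial (by omega)))

/-- The common core of both cases with t = -1. Here w stands for x_3^l, and `hw'` isolates the only
place where they differ, namely x_3 meeting x_3^l. -/
theorem mul_pow_mul_pow_mul_mem {x : Fin 3 → A} {d : k} (h10 : x 1 * x 0 = -(x 0 * x 1))
    (h20 : x 2 * x 0 = -(x 0 * x 2)) (h21 : x 2 * x 1 = -(x 1 * x 2) - d • (x 0 * x 1))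
    (h00 : x 0 * x 0 = 0) (h11 : x 1 * x 1 = 0) {N : ℕ → Submodule k A} {w : A} {l : ℕ}
    (hw : ∀ i < 2, ∀ j < 2, ∀ n, i + j + l ≤ n → x 0 ^ i * x 1 ^ j * w ∈ N n)
    (hw' : ∀ i < 2, ∀ j < 2, x 0 ^ i * x 1 ^ j * (x 2 * w) ∈ N (i + j + l + 1))
    (q : Fin 3) {i j : ℕ} (hi : i < 2) (hj : j < 2) :
    x q * (x 0 ^ i * x 1 ^ j * w) ∈ N (i + j + l + 1) := by
  have e : ∀ (y z u v : A), y * z = u → y * (z * v) = u * v := fun y z u v h => by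
    rw [← mul_assoc, h]
  have h10' := fun v => e _ _ _ v h10
  have h20' := fun v => e _ _ _ v h20
  have h21' := fun v => e _ _ _ v h21
  have h00' := fun v => e _ _ _ v h00
  have h11' := fun v => e _ _ _ v h11
  have a1 := hw 1 (by omega) j hj (i + j + l + 1)
  have a2 := hw i hi 1 (by omega) (i + j + l + 1)
  have a3 := hw' i hi j hj
  fin_cases q <;> interval_cases i <;> interval_cases j
  all_goals
    simp only [pow_zero, pow_one, one_mul, mul_one, mul_assoc, neg_mul, Fin.zero_eta, Fin.mk_one,
      Fin.reduceFinMk, zero_mul, mul_zero, sub_mul, h00', h10', h20', h21', h11', mul_neg, neg_zero,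
      mul_sub, smul_mul_assoc, mul_smul_comm, smul_zero, sub_zero, neg_neg, zero_add] at *
  all_goals first
    | exact zero_mem _
    | exact a3
    | exact neg_mem a3
    | exact a1 (by omega)
    | exact a2 (by omega)
    | exact neg_mem (a2 (by omega))
    | exact sub_mem (neg_mem a3) (Submodule.smul_mem _ _ (a1 (by omega)))

theorem isStraightening_ext {x : Fin 3 → A} {d : k} (h10 : x 1 * x 0 = -(x 0 * x 1))
    (h20 : x 2 * x 0 = -(x 0 * x 2)) (h21 : x 2 * x 1 = -(x 1 * x 2) - d • (x 0 * x 1))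
    (h00 : x 0 * x 0 = 0) (h11 : x 1 * x 1 = 0) : IsStraightening k x B₁ := by
  rintro q e ⟨h0, h1⟩
  refine mul_pow_mul_pow_mul_mem (N := monomialFiltration k x B₁) (w := x 2 ^ e 2) h10 h20 h21
    h00 h11 ?_ ?_ q h0 h1
  · exact fun i hi j hj n hn => pow_mul_pow_mul_pow_mem ⟨hi, hj⟩ hn
  · intro i hi j hj
    rw [← pow_succ']
    exact pow_mul_pow_mul_pow_mem ⟨hi, hj⟩ le_rfl

theorem mem_B₀ {i j l : ℕ} (hi : i < 2) (hj : j < 2) (hl : l < 2) : ![i, j, l] ∈ B₀ := by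
  intro q
  fin_cases q <;> assumption

theorem isStraightening_fin {x : Fin 3 → A} {b d : k} (h10 : x 1 * x 0 = -(x 0 * x 1))
    (h20 : x 2 * x 0 = -(x 0 * x 2)) (h21 : x 2 * x 1 = -(x 1 * x 2) - d • (x 0 * x 1))
    (h00 : x 0 * x 0 = 0) (h11 : x 1 * x 1 = 0) (h22 : x 2 * x 2 = b • (x 0 * x 2)) :
    IsStraightening k x B₀ := by
  intro q e he
  refine mul_pow_mul_pow_mul_mem (N := monomialFiltration k x B₀) (w := x 2 ^ e 2) h10 h20 h21
    h00 h11 ?_ ?_ q (he 0) (he 1)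
  · exact fun i hi j hj n hn => pow_mul_pow_mul_pow_mem (mem_B₀ hi hj (he 2)) hn
  · intro i hi j hj
    have hl := he 2
    interval_cases e 2
    · rw [← pow_succ']
      exact pow_mul_pow_mul_pow_mem (mem_B₀ hi hj one_lt_two) le_rfl
    -- Here x_3^2 becomes b x_1 x_3. Moving x_1 to the front costs a sign for j = 1 and gives zero
    -- for i = 1.
    · rw [pow_one, h22]
      have h00' : ∀ v, x 0 * (x 0 * v) = 0 := fun v => by rw [← mul_assoc, h00, zero_mul]
      have h10' : x 1 * (x 0 * x 2) = -(x 0 * (x 1 * x 2)) := by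
        rw [← mul_assoc, h10, neg_mul, mul_assoc]
      have m := fun (j : ℕ) (hj : j < 2) n => pow_mul_pow_mul_pow_mem (k := k) (x := x) (n := n)
        (mem_B₀ one_lt_two hj one_lt_two)
      simp only [mul_smul_comm]
      refine Submodule.smul_mem _ _ ?_
      interval_cases i <;> interval_cases j
      · simpa using m 0 zero_lt_two 2 le_rfl
      · simpa [h10', mul_assoc] using m 1 one_lt_two 3 le_rfl
      · simp [h00']
      · simp [h10', h00', mul_assoc]

end OrderedMonomials

/-! ### From straightening and independence to relations and basis. -/

section Quotient

variable {k : Type*} [Field k]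

theorem mk_eq_zero_iff {I : TwoSidedIdeal (T k (Fin 3))} {u : T k (Fin 3)} :
    I.ringCon.mkₐ k u = 0 ↔ u ∈ I := by
  conv_rhs => rw [← TwoSidedIdeal.ker_ringCon_mk' I]
  exact (TwoSidedIdeal.mem_ker _).symm

theorem mk_mono (I : TwoSidedIdeal (T k (Fin 3))) (e : Fin 3 → ℕ) :
    I.ringCon.mkₐ k (mono k e) = orderedMonomial (fun i => I.ringCon.mkₐ k (gen k i)) e := by
  simp only [mono, orderedMonomial, map_mul, map_pow]

theorem IsStraightening.exists_mk_mem {I : TwoSidedIdeal (T k (Fin 3))} {S : Set (Fin 3 → ℕ)}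
    (h0 : 0 ∈ S) (h : IsStraightening k (fun i => I.ringCon.mkₐ k (gen k i)) S)
    (u : T k (Fin 3)) : ∃ n, I.ringCon.mkₐ k u ∈
      monomialFiltration k (fun i => I.ringCon.mkₐ k (gen k i)) S n := by
  induction u using T_induction with
  | one =>
    refine ⟨0, Submodule.subset_span ⟨0, ⟨h0, by simp⟩, ?_⟩⟩
    simp [orderedMonomial]
  | mul i u hu =>
    obtain ⟨n, hn⟩ := hu
    exact ⟨n + 1, by rw [map_mul]; exact h.mul_mem i hn⟩
  | add u v hu hv =>
    obtain ⟨n, hn⟩ := hu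
    obtain ⟨m, hm⟩ := hv
    rw [map_add]
    exact ⟨max n m, add_mem (monomialFiltration_mono _ _ (le_max_left _ _) hn)
      (monomialFiltration_mono _ _ (le_max_right _ _) hm)⟩
  | smul r u hu =>
    obtain ⟨n, hn⟩ := hu
    exact ⟨n, by rw [map_smul]; exact Submodule.smul_mem _ _ hn⟩

theorem exists_sum_mem_of_isStraightening {I : TwoSidedIdeal (T k (Fin 3))}
    {S : Set (Fin 3 → ℕ)} (h0 : 0 ∈ S)
    (h : IsStraightening k (fun i => I.ringCon.mkₐ k (gen k i)) S) (u : T k (Fin 3)) :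
    ∃ (s : Finset (Fin 3 → ℕ)) (g : (Fin 3 → ℕ) → k), (s : Set (Fin 3 → ℕ)) ⊆ S ∧
      u - ∑ e ∈ s, g e • mono k e ∈ I := by
  obtain ⟨n, hn⟩ := h.exists_mk_mem h0 u
  rw [monomialFiltration, Finsupp.mem_span_image_iff_linearCombination] at hn
  obtain ⟨c, hc, hcu⟩ := hn
  refine ⟨c.support, c, fun e he => (hc he).1, ?_⟩
  rw [← mk_eq_zero_iff, map_sub, ← hcu, Finsupp.linearCombination_apply, Finsupp.sum, map_sum,
    sub_eq_zero]
  exact Finset.sum_congr rfl fun e _ => by rw [map_smul, mk_mono]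

/-- An element of J agrees modulo G with a combination of ordered monomials. This combination lies
in J too, so by independence its coefficients vanish. -/
theorem nicholsIdeal_eq_span {B : Braiding k (Fin 3)} {G : Set (T k (Fin 3))}
    (hG : G ⊆ nicholsIdeal B) {S : Set (Fin 3 → ℕ)} (h0 : 0 ∈ S)
    (h : IsStraightening k
      (fun i => (TwoSidedIdeal.span G).ringCon.mkₐ k (gen k i)) S)
    (hind : ∀ (s : Finset (Fin 3 → ℕ)), (s : Set (Fin 3 → ℕ)) ⊆ S → ∀ g : (Fin 3 → ℕ) → k,
      ∑ e ∈ s, g e • mono k e ∈ nicholsIdeal B → ∀ e ∈ s, g e = 0) :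
    nicholsIdeal B = TwoSidedIdeal.span G := by
  have hle : TwoSidedIdeal.span G ≤ nicholsIdeal B := TwoSidedIdeal.span_le.2 hG
  refine le_antisymm (fun u hu => ?_) hle
  obtain ⟨s, g, hs, hsu⟩ := exists_sum_mem_of_isStraightening h0 h u
  have hz := hind s hs g (by simpa using sub_mem hu (hle hsu))
  rwa [Finset.sum_eq_zero fun e he => by rw [hz e he, zero_smul], sub_zero] at hsu

theorem isMonomialBasis_of_isStraightening {B : Braiding k (Fin 3)} {S : Set (Fin 3 → ℕ)}
    (h0 : 0 ∈ S)
    (h : IsStraightening k (fun i => (nicholsIdeal B).ringCon.mkₐ k (gen k i)) S)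
    (hind : ∀ (s : Finset (Fin 3 → ℕ)), (s : Set (Fin 3 → ℕ)) ⊆ S → ∀ g : (Fin 3 → ℕ) → k,
      ∑ e ∈ s, g e • mono k e ∈ nicholsIdeal B → ∀ e ∈ s, g e = 0) :
    IsMonomialBasis B S := by
  constructor
  · rw [linearIndependent_iff']
    intro s g hg e he
    classical
    let g' : (Fin 3 → ℕ) → k := fun e => if h : e ∈ S then g ⟨e, h⟩ else 0
    have := hind (s.map (Function.Embedding.subtype _))
      (by rintro _ he; obtain ⟨e, -, rfl⟩ := Finset.mem_map.1 he; exact e.2) g' ?_ e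
      (by simpa using he)
    · simpa [g'] using this
    · rw [← mk_eq_zero_iff, map_sum, Finset.sum_map, ← hg]
      refine Finset.sum_congr rfl fun e _ => ?_
      rw [map_smul, mk_mono]
      simp [g']
      rfl
  · rw [eq_top_iff]
    rintro z -
    obtain ⟨u, rfl⟩ := RingCon.mkₐ_surjective (α := k) _ z
    obtain ⟨n, hn⟩ := h.exists_mk_mem h0 u
    refine Submodule.span_mono ?_ hn
    rintro _ ⟨e, he, rfl⟩
    exact ⟨⟨e, he.1⟩, rfl⟩

theorem isStraightening_of_relSym {a b : k} {I : TwoSidedIdeal (T k (Fin 3))}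
    (hI : relSym a b ⊆ I) :
    IsStraightening k (fun i => I.ringCon.mkₐ k (gen k i)) B₃ := by
  have h : ∀ r ∈ relSym a b, I.ringCon.mkₐ k r = 0 := fun r hr => mk_eq_zero_iff.2 (hI hr)
  simp only [relSym, Set.mem_insert_iff, Set.mem_singleton_iff, forall_eq_or_imp, forall_eq,
    map_add, map_sub, map_mul, map_smul, map_pow] at h
  obtain ⟨h1, h2, h3⟩ := h
  refine isStraightening_sym (a := a) (d := a - 2 * b) (sub_eq_zero.1 h1) ?_ ?_
  · rw [← sub_eq_zero, ← h2]
    abel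
  · rw [← sub_eq_zero, ← h3]
    abel

theorem isStraightening_of_relExt {a b : k} {I : TwoSidedIdeal (T k (Fin 3))}
    (hI : relExt a b ⊆ I) :
    IsStraightening k (fun i => I.ringCon.mkₐ k (gen k i)) B₁ := by
  have h : ∀ r ∈ relExt a b, I.ringCon.mkₐ k r = 0 := fun r hr => mk_eq_zero_iff.2 (hI hr)
  simp only [relExt, Set.mem_insert_iff, Set.mem_singleton_iff, forall_eq_or_imp, forall_eq,
    map_add, map_mul, map_smul, pow_two] at h
  obtain ⟨h1, h2, h3, h4, h5⟩ := h
  refine isStraightening_ext (d := a - 2 * b) (eq_neg_of_add_eq_zero_left h1)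
    (eq_neg_of_add_eq_zero_left h2) ?_ h4 h5
  rw [← sub_eq_zero, ← h3]
  abel

theorem isStraightening_of_relFin {a b : k} {I : TwoSidedIdeal (T k (Fin 3))}
    (hI : relFin a b ⊆ I) :
    IsStraightening k (fun i => I.ringCon.mkₐ k (gen k i)) B₀ := by
  have h : ∀ r ∈ relFin a b, I.ringCon.mkₐ k r = 0 := fun r hr => mk_eq_zero_iff.2 (hI hr)
  simp only [relFin, Set.mem_insert_iff, Set.mem_singleton_iff, forall_eq_or_imp, forall_eq,
    map_add, map_sub, map_mul, map_smul, pow_two] at h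
  obtain ⟨h1, h2, h3, h4, h5, h6⟩ := h
  refine isStraightening_fin (b := b) (d := a - 2 * b) (eq_neg_of_add_eq_zero_left h1)
    (eq_neg_of_add_eq_zero_left h2) ?_ h4 h5 (sub_eq_zero.1 h6)
  rw [← sub_eq_zero, ← h3]
  abel

end Quotient

end BraidedRank

namespace BraidedRank

/-! ### Growth of the monomial filtration and the Gelfand–Kirillov dimension. -/

section Growth

open Filter Topology

variable {k A : Type*} [Field k] [Ring A] [Algebra k A]

theorem tendsto_log_mul_pow_div_log {C : ℝ} (hC : 0 < C) (g : ℕ) :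
    Tendsto (fun n : ℕ => ((Real.log (C * (n : ℝ) ^ g) / Real.log n : ℝ) : EReal)) atTop
      (𝓝 (g : EReal)) := by
  have h1 : Tendsto (fun n : ℕ => Real.log C / Real.log n + g) atTop (𝓝 (0 + g)) :=
    (tendsto_const_nhds.div_atTop
      (Real.tendsto_log_atTop.comp tendsto_natCast_atTop_atTop)).add tendsto_const_nhds
  rw [zero_add] at h1
  have h2 : Tendsto (fun n : ℕ => Real.log (C * (n : ℝ) ^ g) / Real.log n) atTop (𝓝 (g : ℝ)) := by
    refine h1.congr' ?_
    filter_upwards [eventually_gt_atTop 1] with n hn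
    have hn' : (1 : ℝ) < n := by exact_mod_cast hn
    have hlog := Real.log_pos hn'
    rw [Real.log_mul hC.ne' (by positivity), Real.log_pow]
    field_simp
  exact_mod_cast (continuous_coe_real_ereal.tendsto _).comp h2

theorem gkDim_le {g : ℕ}
    (h : ∀ W : Submodule k A, W.FG → ∃ C : ℝ, 0 < C ∧ ∀ n : ℕ, 1 ≤ n →
      (Module.finrank k ((1 ⊔ W) ^ n : Submodule k A) : ℝ) ≤ C * (n : ℝ) ^ g) :
    gkDim k A ≤ g := by
  refine iSup_le fun W => ?_
  obtain ⟨C, hC, hW⟩ := h W.1 W.2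
  -- A constant at least 1 keeps the bounding logarithm nonnegative, which covers rank 0, where
  -- `Real.log 0 = 0`.
  have hC' : 0 < max C 1 := lt_max_of_lt_left hC
  rw [← (tendsto_log_mul_pow_div_log hC' g).limsup_eq]
  refine limsup_le_limsup ?_
  filter_upwards [eventually_ge_atTop 1] with n hn
  have hn' : (1 : ℝ) ≤ n := by exact_mod_cast hn
  rw [EReal.coe_le_coe_iff]
  refine div_le_div_of_nonneg_right ?_ (Real.log_nonneg hn')
  have hng : (1 : ℝ) ≤ (n : ℝ) ^ g := one_le_pow₀ hn'
  rcases Nat.eq_zero_or_pos (Module.finrank k ((1 ⊔ W.1) ^ n : Submodule k A)) with h0 | h0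
  · rw [h0, Nat.cast_zero, Real.log_zero]
    exact Real.log_nonneg (one_le_mul_of_one_le_of_one_le (le_max_right _ _) hng)
  · refine Real.log_le_log (by exact_mod_cast h0) ((hW n hn).trans ?_)
    exact mul_le_mul_of_nonneg_right (le_max_left _ _) (by positivity)

theorem le_gkDim {g : ℕ} {W : Submodule k A} (hW : W.FG) {C : ℝ} (hC : 0 < C)
    (h : ∀ n : ℕ, 1 ≤ n →
      C * (n : ℝ) ^ g ≤ Module.finrank k ((1 ⊔ W) ^ n : Submodule k A)) :
    g ≤ gkDim k A := by
  refine le_iSup_of_le ⟨W, hW⟩ ?_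
  rw [← (tendsto_log_mul_pow_div_log hC g).limsup_eq]
  refine limsup_le_limsup ?_
  filter_upwards [eventually_ge_atTop 1] with n hn
  have hn' : (1 : ℝ) ≤ n := by exact_mod_cast hn
  rw [EReal.coe_le_coe_iff]
  exact div_le_div_of_nonneg_right (Real.log_le_log (by positivity) (h n hn))
    (Real.log_nonneg hn')

variable {x : Fin 3 → A} {S : Set (Fin 3 → ℕ)}

theorem finite_degree_le (S : Set (Fin 3 → ℕ)) (n : ℕ) :
    {e | e ∈ S ∧ e 0 + e 1 + e 2 ≤ n}.Finite := by
  refine (Set.finite_Iic (fun _ : Fin 3 => n)).subset fun e he i => ?_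
  have := he.2
  fin_cases i <;> simp <;> omega

theorem monomialFiltration_fg (k : Type*) [Field k] [Algebra k A] (x : Fin 3 → A)
    (S : Set (Fin 3 → ℕ)) (n : ℕ) : (monomialFiltration k x S n).FG :=
  Submodule.fg_span ((finite_degree_le S n).image _)

theorem finrank_monomialFiltration_le (x : Fin 3 → A) (S : Set (Fin 3 → ℕ)) (n : ℕ) :
    Module.finrank k (monomialFiltration k x S n) ≤
      {e | e ∈ S ∧ e 0 + e 1 + e 2 ≤ n}.ncard := by
  have hf := finite_degree_le S n
  have := (hf.image (orderedMonomial x)).fintype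
  refine (finrank_span_le_card (R := k) _).trans ?_
  rw [← Set.ncard_eq_toFinset_card']
  exact Set.ncard_image_le hf

theorem finrank_monomialFiltration (hli : LinearIndependent k fun e : S => orderedMonomial x e)
    (n : ℕ) : Module.finrank k (monomialFiltration k x S n) =
      {e | e ∈ S ∧ e 0 + e 1 + e 2 ≤ n}.ncard := by
  have := (finite_degree_le S n).fintype
  let E := {e | e ∈ S ∧ e 0 + e 1 + e 2 ≤ n}
  have h : LinearIndependent k fun e : E => orderedMonomial x e :=
    hli.comp (fun e : E => (⟨e.1, e.2.1⟩ : S)) fun e e' h => by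
      simpa [Subtype.ext_iff] using h
  rw [monomialFiltration, Set.image_eq_range, finrank_span_eq_card h, ← Nat.card_eq_fintype_card,
    Nat.card_coe_set_eq]

/-- Left multiplication by generators suffices: an ordered monomial of degree at most m is a word of
at most m letters, applied one after another. -/
theorem IsStraightening.mul_mem_monomialFiltration (h : IsStraightening k x S) {m n : ℕ} {u v : A}
    (hu : u ∈ monomialFiltration k x S m) (hv : v ∈ monomialFiltration k x S n) :
    u * v ∈ monomialFiltration k x S (m + n) := by
  have hp : ∀ (q : Fin 3) (i : ℕ) {n : ℕ} {v : A}, v ∈ monomialFiltration k x S n →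
      x q ^ i * v ∈ monomialFiltration k x S (n + i) := by
    intro q i n v hv
    induction i with
    | zero => simpa
    | succ i ih => rw [pow_succ', mul_assoc]; exact h.mul_mem q ih
  refine (Submodule.span_le
    (p := (monomialFiltration k x S (m + n)).comap (LinearMap.mulRight k v))).2 ?_ hu
  rintro _ ⟨e, he, rfl⟩
  rw [SetLike.mem_coe, Submodule.mem_comap, LinearMap.mulRight_apply, orderedMonomial, mul_assoc,
    mul_assoc]
  exact monomialFiltration_mono x S (by have := he.2; omega) (hp 0 _ (hp 1 _ (hp 2 _ hv)))

theorem one_mem_monomialFiltration (h0 : 0 ∈ S) (n : ℕ) :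
    (1 : A) ∈ monomialFiltration k x S n :=
  Submodule.subset_span ⟨0, ⟨h0, by simp⟩, by simp [orderedMonomial]⟩

theorem IsStraightening.pow_le (h : IsStraightening k x S) (h0 : 0 ∈ S) {W : Submodule k A}
    {d : ℕ} (hW : W ≤ monomialFiltration k x S d) (n : ℕ) :
    (1 ⊔ W) ^ n ≤ monomialFiltration k x S (d * n) := by
  have h1 : 1 ⊔ W ≤ monomialFiltration k x S d :=
    sup_le (Submodule.one_le.2 (one_mem_monomialFiltration h0 d)) hW
  induction n with
  | zero => exact (pow_zero (1 ⊔ W)).trans_le (Submodule.one_le.2 (one_mem_monomialFiltration h0 _))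
  | succ n ih =>
    rw [pow_succ]
    exact Submodule.mul_le.2 fun u hu v hv => h.mul_mem_monomialFiltration (ih hu) (h1 hv)

theorem exists_le_monomialFiltration
    (hspan : Submodule.span k (Set.range fun e : S => orderedMonomial x e) = ⊤)
    {W : Submodule k A} (hW : W.FG) : ∃ d, 1 ≤ d ∧ W ≤ monomialFiltration k x S d := by
  have h1 : ∀ u : A, ∃ d, u ∈ monomialFiltration k x S d := by
    intro u
    have hu : u ∈ Submodule.span k (Set.range fun e : S => orderedMonomial x e) := hspan ▸ trivial
    have : Submodule.span k (Set.range fun e : S => orderedMonomial x e) ≤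
        ⨆ d, monomialFiltration k x S d := by
      refine Submodule.span_le.2 ?_
      rintro _ ⟨e, rfl⟩
      exact Submodule.mem_iSup_of_mem (e.1 0 + e.1 1 + e.1 2)
        (Submodule.subset_span ⟨e, ⟨e.2, le_rfl⟩, rfl⟩)
    exact (Submodule.mem_iSup_of_directed _ (monomialFiltration_mono x S).directed_le).1 (this hu)
  choose d hd using h1
  obtain ⟨s, rfl⟩ := hW
  refine ⟨s.sup d + 1, by omega, Submodule.span_le.2 fun u hu => ?_⟩
  exact monomialFiltration_mono x S ((Finset.le_sup hu).trans (Nat.le_succ _)) (hd u)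

theorem monomialFiltration_le_pow (n : ℕ) :
    monomialFiltration k x S n ≤ (1 ⊔ Submodule.span k (Set.range x)) ^ n := by
  set W := 1 ⊔ Submodule.span k (Set.range x) with hW
  have h1 : (1 : Submodule k A) ≤ W := le_sup_left
  have hx : ∀ q, x q ∈ W := fun q =>
    (le_sup_right : _ ≤ W) (Submodule.subset_span ⟨q, rfl⟩)
  refine Submodule.span_le.2 ?_
  rintro _ ⟨e, he, rfl⟩
  have : orderedMonomial x e ∈ W ^ (e 0 + e 1 + e 2) := by
    rw [pow_add, pow_add]
    exact Submodule.mul_mem_mul (Submodule.mul_mem_mul (Submodule.pow_mem_pow _ (hx 0) _)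
      (Submodule.pow_mem_pow _ (hx 1) _)) (Submodule.pow_mem_pow _ (hx 2) _)
  exact pow_le_pow_right₀ h1 he.2 this

/-- A finite-dimensional W lies in some filtration step d, so (k + W)^n lies in step dn, which
bounds the growth from above. The span of the generators attains the rate, since its n-th power
contains step n. -/
theorem gkDim_eq (h : IsStraightening k x S) (h0 : 0 ∈ S)
    (hli : LinearIndependent k fun e : S => orderedMonomial x e)
    (hspan : Submodule.span k (Set.range fun e : S => orderedMonomial x e) = ⊤) {g : ℕ} {c C : ℝ}
    (hc : 0 < c) (hC : 0 < C)
    (hlow : ∀ n : ℕ, c * (n : ℝ) ^ g ≤ {e | e ∈ S ∧ e 0 + e 1 + e 2 ≤ n}.ncard)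
    (hup : ∀ n : ℕ, ({e | e ∈ S ∧ e 0 + e 1 + e 2 ≤ n}.ncard : ℝ) ≤ C * (n + 1 : ℝ) ^ g) :
    gkDim k A = g := by
  refine le_antisymm (gkDim_le fun W hW => ?_) (le_gkDim (W := Submodule.span k (Set.range x))
    (Submodule.fg_span (Set.finite_range x)) hc fun n hn => (hlow n).trans ?_)
  · obtain ⟨d, hd, hWd⟩ := exists_le_monomialFiltration hspan hW
    -- From dn + 1 ≤ (d + 1)n for n ≥ 1.
    refine ⟨C * (d + 1 : ℝ) ^ g, by positivity, fun n hn => ?_⟩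
    have := Module.Finite.of_fg (monomialFiltration_fg k x S (d * n))
    have h1 := Submodule.finrank_mono (h.pow_le h0 hWd n)
    have h2 := h1.trans (finrank_monomialFiltration_le x S (d * n))
    refine (Nat.cast_le.2 h2).trans ((hup (d * n)).trans ?_)
    rw [mul_assoc, ← mul_pow]
    have hn' : (1 : ℝ) ≤ n := by exact_mod_cast hn
    gcongr
    push_cast
    linarith
  · have hfg : ((1 ⊔ Submodule.span k (Set.range x)) ^ n : Submodule k A).FG :=
      (Submodule.FG.sup (Submodule.one_eq_span (R := k) (A := A) ▸ Submodule.fg_span_singleton 1)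
        (Submodule.fg_span (Set.finite_range x))).pow n
    have := Module.Finite.of_fg hfg
    rw [← finrank_monomialFiltration hli]
    exact_mod_cast Submodule.finrank_mono (monomialFiltration_le_pow n)

theorem ncard_le_prod {E : Set (Fin 3 → ℕ)} (s : Fin 3 → Finset ℕ) (h : ∀ e ∈ E, ∀ i, e i ∈ s i) :
    E.ncard ≤ (s 0).card * (s 1).card * (s 2).card := by
  have : E ⊆ (Fintype.piFinset s : Set (Fin 3 → ℕ)) := fun e he => by simpa using h e he
  refine (Set.ncard_le_ncard this (Finset.finite_toSet _)).trans ?_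
  rw [Set.ncard_coe_finset, Fintype.card_piFinset, Fin.prod_univ_three]

theorem prod_le_ncard {E : Set (Fin 3 → ℕ)} (hE : E.Finite) (s : Fin 3 → Finset ℕ)
    (h : ∀ e : Fin 3 → ℕ, (∀ i, e i ∈ s i) → e ∈ E) :
    (s 0).card * (s 1).card * (s 2).card ≤ E.ncard := by
  have : (Fintype.piFinset s : Set (Fin 3 → ℕ)) ⊆ E := fun e he => h e (by simpa using he)
  refine le_trans ?_ (Set.ncard_le_ncard this hE)
  rw [Set.ncard_coe_finset, Fintype.card_piFinset, Fin.prod_univ_three]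

theorem gkDim_eq_three (h : IsStraightening k x B₃)
    (hli : LinearIndependent k fun e : B₃ => orderedMonomial x e)
    (hspan : Submodule.span k (Set.range fun e : B₃ => orderedMonomial x e) = ⊤) :
    gkDim k A = 3 := by
  refine (gkDim_eq h trivial hli hspan (g := 3) (c := 1 / 27) (C := 1) (by norm_num) one_pos
    (fun n => ?_) fun n => ?_).trans (by norm_num)
  -- Exponents at most ⌊n/3⌋ have sum at most n, and ⌊n/3⌋ + 1 ≥ n/3 explains the constant 1/27.
  · have h1 := prod_le_ncard (finite_degree_le B₃ n) (fun _ => Finset.range (n / 3 + 1))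
      fun e he => by
        have h0 := he 0
        have h1 := he 1
        have h2 := he 2
        simp only [Finset.mem_range] at h0 h1 h2
        exact ⟨trivial, by omega⟩
    refine le_trans ?_ (Nat.cast_le.2 h1)
    have h3 : (n : ℝ) ≤ 3 * ((n / 3 + 1 : ℕ) : ℝ) := by exact_mod_cast (by omega)
    rw [Finset.card_range]
    push_cast at h3 ⊢
    have h4 := pow_le_pow_left₀ (Nat.cast_nonneg n) h3 3
    nlinarith
  · have h1 := ncard_le_prod (E := {e | e ∈ B₃ ∧ e 0 + e 1 + e 2 ≤ n})
      (fun _ => Finset.range (n + 1)) fun e he i => by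
        have := he.2
        fin_cases i <;> simp <;> omega
    refine (Nat.cast_le.2 h1).trans (le_of_eq ?_)
    rw [Finset.card_range]
    push_cast
    ring

theorem gkDim_eq_one (h : IsStraightening k x B₁)
    (hli : LinearIndependent k fun e : B₁ => orderedMonomial x e)
    (hspan : Submodule.span k (Set.range fun e : B₁ => orderedMonomial x e) = ⊤) :
    gkDim k A = 1 := by
  refine (gkDim_eq h (by simp [B₁]) hli hspan (g := 1) (c := 1) (C := 4) one_pos (by norm_num)
    (fun n => ?_) fun n => ?_).trans (by norm_num)
  -- The powers of x_3 alone already give linear growth.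
  · have h1 := prod_le_ncard (finite_degree_le B₁ n) ![{0}, {0}, Finset.range (n + 1)]
      fun e he => by
        have h0 := he 0
        have h1 := he 1
        have h2 := he 2
        simp at h0 h1 h2
        exact ⟨⟨by omega, by omega⟩, by omega⟩
    refine le_trans ?_ (Nat.cast_le.2 h1)
    simp
  · have h1 := ncard_le_prod (E := {e | e ∈ B₁ ∧ e 0 + e 1 + e 2 ≤ n})
      ![Finset.range 2, Finset.range 2, Finset.range (n + 1)] fun e he i => by
        have := he.2
        have h0 := he.1.1
        have h1 := he.1.2
        fin_cases i <;> simp <;> omega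
    refine (Nat.cast_le.2 h1).trans (le_of_eq ?_)
    simp

theorem gkDim_eq_zero (h : IsStraightening k x B₀)
    (hli : LinearIndependent k fun e : B₀ => orderedMonomial x e)
    (hspan : Submodule.span k (Set.range fun e : B₀ => orderedMonomial x e) = ⊤) :
    gkDim k A = 0 := by
  refine (gkDim_eq h (by simp [B₀]) hli hspan (g := 0) (c := 1) (C := 8) one_pos (by norm_num)
    (fun n => ?_) fun n => ?_).trans (by norm_num)
  · have h1 := prod_le_ncard (finite_degree_le B₀ n) ![{0}, {0}, {0}] fun e he => by
      have h0 := he 0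
      have h1 := he 1
      have h2 := he 2
      simp at h0 h1 h2
      refine ⟨fun i => ?_, by omega⟩
      fin_cases i <;> simp <;> omega
    refine le_trans ?_ (Nat.cast_le.2 h1)
    simp
  · have h1 := ncard_le_prod (E := {e | e ∈ B₀ ∧ e 0 + e 1 + e 2 ≤ n})
      (fun _ => Finset.range 2) fun e he i => Finset.mem_range.2 (he.1 i)
    refine (Nat.cast_le.2 h1).trans ?_
    simp

theorem finrank_eq_eight (hli : LinearIndependent k fun e : B₀ => orderedMonomial x e)
    (hspan : Submodule.span k (Set.range fun e : B₀ => orderedMonomial x e) = ⊤) :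
    Module.finrank k A = 8 := by
  rw [Module.finrank_eq_nat_card_basis (Module.Basis.mk hli hspan.ge), Nat.card_coe_set_eq]
  have : B₀ = (Fintype.piFinset fun _ : Fin 3 => Finset.range 2 : Set (Fin 3 → ℕ)) := by
    ext e
    simp [B₀]
  rw [this, Set.ncard_coe_finset, Fintype.card_piFinset]
  simp

end Growth

end BraidedRank

/-! ### The four cases. -/

open BraidedRank in
theorem proposition3p9 {k : Type*} [Field k] [IsAlgClosed k] [CharZero k]
    (t a b p : k) (ht : t ≠ 0) :
    let V : Braiding k (Fin 3) := braiding14 t a b p ht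
    let x₁ : T k (Fin 3) := FreeAlgebra.ι k 0
    let x₂ : T k (Fin 3) := FreeAlgebra.ι k 1
    let x₃ : T k (Fin 3) := FreeAlgebra.ι k 2
    (t ^ 2 ≠ 1 → quadraticRelations V = ⊥) ∧
    (t = 1 →
      nicholsIdeal V = TwoSidedIdeal.span
        {x₂ * x₁ - x₁ * x₂,
         x₃ * x₁ - x₁ * x₃ - a • x₁ ^ 2,
         x₃ * x₂ - x₂ * x₃ + (a - 2 * b) • (x₁ * x₂)} ∧
      IsMonomialBasis V B₃ ∧
      gkDim k (NicholsAlgebra V) = 3) ∧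
    (t = -1 → p ≠ 0 →
      nicholsIdeal V = TwoSidedIdeal.span
        {x₂ * x₁ + x₁ * x₂,
         x₃ * x₁ + x₁ * x₃,
         x₃ * x₂ + x₂ * x₃ + (a - 2 * b) • (x₁ * x₂),
         x₁ ^ 2,
         x₂ ^ 2} ∧
      IsMonomialBasis V B₁ ∧
      gkDim k (NicholsAlgebra V) = 1) ∧
    (t = -1 → p = 0 →
      nicholsIdeal V = TwoSidedIdeal.span
        {x₂ * x₁ + x₁ * x₂,
         x₃ * x₁ + x₁ * x₃,
         x₃ * x₂ + x₂ * x₃ + (a - 2 * b) • (x₁ * x₂),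
         x₁ ^ 2,
         x₂ ^ 2,
         x₃ ^ 2 - b • (x₁ * x₃)} ∧
      IsMonomialBasis V B₀ ∧
      gkDim k (NicholsAlgebra V) = 0 ∧
      Module.finrank k (NicholsAlgebra V) = 8) := by
  intro V x₁ x₂ x₃
  refine ⟨fun h => quadraticRelations_eq_bot fun f hf => eq_zero_of_inKer_braiding14 h hf,
    fun h1 => ?_, fun h1 hp => ?_, fun h1 hp => ?_⟩
  · have hG : relSym a b ⊆ nicholsIdeal V := relSym_subset h1
    have hind := coeff_eq_zero_of_sum_mem_of_qFactorial (ht := ht) (a := a) (b := b) (p := p)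
      (S := B₃) fun e _ i => h1 ▸ qFactorial_one_ne_zero (e i)
    have h0 : (0 : Fin 3 → ℕ) ∈ B₃ := trivial
    have hst := isStraightening_of_relSym hG
    have hB := isMonomialBasis_of_isStraightening (B := V) h0 hst hind
    exact ⟨nicholsIdeal_eq_span hG h0
      (isStraightening_of_relSym TwoSidedIdeal.subset_span) hind, hB,
      gkDim_eq_three hst hB.1 hB.2⟩
  · have hG : relExt a b ⊆ nicholsIdeal V := relExt_subset h1
    have hind := coeff_eq_zero_of_sum_mem_of_ne_zero (ht := ht) (a := a) (b := b) h1 hp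
    have h0 : (0 : Fin 3 → ℕ) ∈ B₁ := by simp [B₁]
    have hst := isStraightening_of_relExt hG
    have hB := isMonomialBasis_of_isStraightening (B := V) h0 hst hind
    exact ⟨nicholsIdeal_eq_span hG h0
      (isStraightening_of_relExt TwoSidedIdeal.subset_span) hind, hB,
      gkDim_eq_one hst hB.1 hB.2⟩
  · have hG : relFin a b ⊆ nicholsIdeal V := relFin_subset h1 hp
    have hind := coeff_eq_zero_of_sum_mem_of_qFactorial (ht := ht) (a := a) (b := b) (p := p)
      (S := B₀) fun e he i => qFactorial_ne_zero_of_lt_two t (he i)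
    have h0 : (0 : Fin 3 → ℕ) ∈ B₀ := by simp [B₀]
    have hst := isStraightening_of_relFin hG
    have hB := isMonomialBasis_of_isStraightening (B := V) h0 hst hind
    exact ⟨nicholsIdeal_eq_span hG h0
      (isStraightening_of_relFin TwoSidedIdeal.subset_span) hind, hB,
      gkDim_eq_zero hst hB.1 hB.2,
      finrank_eq_eight (x := fun i => (nicholsIdeal V).ringCon.mkₐ k (gen k i)) hB.1 hB.2⟩
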